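/- Let $d\ge 1$. For a rectangular domain $\Omega=\prod_{i=1}^d(a_i,a_i+n_ih)$ ($n_i\ge1$ integers, $h>0$) let $\mathcal T_h$ be the uniform Cartesian mesh of $\Omega$ by cubes of edge length $h$ and $\mathcal F_h$ the set of all its interior and boundary faces. For $k\ge 1$ let $U_k$ be the space of functions that on each $T\in\mathcal T_h$ are polynomials of degree at most $k$ in each variable, with the basis $\Psi_T^{\sigma}$ ($T\in\mathcal T_h$, $\sigma\in\{0,\dots,k\}^d$) of tensor-product Legendre polynomials $\prod_i l_{\sigma_i}$ (normalised by $l_n(1)=1$) transported affinely from $[-1,1]^d$ to $T$ and extended by zero. For $\alpha_0>0$ let $$\mathcal A_k(u,v)=\sum_{T}(\nabla u,\nabla v)_T-\sum_{F}\langle\{\nabla u\}\cdot n,[v]\rangle_F-\sum_F\langle\{\nabla v\}\cdot n,[u]\rangle_F+\sum_F\frac{\alpha_0k^2}{h}\langle[u],[v]\rangle_F,$$ the sums being over $T\in\mathcal T_h$ and $F\in\mathcal F_h$. On an interior face $F=T_1\cap T_2$, $\{u\}=\frac12(u|_{T_1}+u|_{T_2})$, $[u]=u|_{T_1}-u|_{T_2}$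 and $n$ is the unit normal pointing from $T_1$ to $T_2$; on a boundary face $\{u\}=[u]=u$ and $n$ is the outward unit normal. Let $\mathbb A_k$ and $\mathbb M_k$ be the matrices of $\mathcal A_k$ and of the $L^2(\Omega)$ inner product in the basis $(\Psi_T^\sigma)$, $\mathbb D_k$ the diagonal part of $\mathbb A_k$, $\rho$ the spectral radius, and $\|\mathbf v\|_{\mathbb A_k,s}=(\mathbf v^{\top}\mathbb A_k^s\mathbf v)^{1/2}$ (so $\|\cdot\|_{\mathbb A_k,0}$ is the Euclidean norm). Let $P_0(x)=1$, $P_1(x)=1-\frac43x$ and $P_i(x)=\frac{4i-2}{2i+1}(1-2x)P_{i-1}(x)-\frac{2i-3}{2i+1}P_{i-2}(x)$ for $i\ge2$, so that $P_m(\omega\mathbb D_k^{-1}\mathbb A_k)$ is the error propagation matrix of $m$ steps of the fourth-kind Chebyshev iteration with damping parameter $\omega$. There is $\alpha_{\min}>0$, depending only on $d$, such that for every $\alpha_0\ge\alpha_{\min}$ the following holds. The matrices $\mathbb M_k$ and $\mathbb A_k$ are symmetric positive definite for all such meshes and all $k\ge1$. Moreover (pre-smoothing property), for every $c>0$ there is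 a constant $C>0$, depending only on $d$, $\alpha_0$ and $c$ (hence independent of the mesh, $h$, $k$ and $m$), such that for all such meshes, all $k\ge1$, all $m\ge1$ and all damping parameters $\omega_k$ with $$\omega_k\ge\frac{c}{k+1}\qquad\text{and}\qquad \omega_k\,\rho(\mathbb D_k^{-1}\mathbb A_k)\le1,$$ one has, for every coefficient vector $\mathbf g$, $$\big\|\mathbb M_k^{-1/2}\mathbb A_kP_m(\omega_k\mathbb D_k^{-1}\mathbb A_k)\,\mathbf g\big\|_{\mathbb A_k,0}\le C\,\frac{k^2}{h\,m}\,\|\mathbf g\|_{\mathbb A_k,1}.$$ -/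

import Mathlib

open Polynomial MeasureTheory

noncomputable section

namespace IPDG

/-- The Legendre polynomial `l_n` on `[-1, 1]`, by Rodrigues' formula (so `l_n(1) = 1`). -/
def legendre (n : ℕ) : ℝ[X] :=
  C (1 / (2 ^ n * (n.factorial : ℝ))) * (Polynomial.derivative^[n]) ((X ^ 2 - 1) ^ n)

/-- A uniform Cartesian mesh of the rectangular domain `∏ i, (a i, a i + n i * h)` in `ℝ^(d+1)`
by closed cubes of edge length `h`; there are `n i ≥ 1` layers of cubes in direction `i`.
The space dimension is `d + 1`, i.e. an arbitrary positive integer. -/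
structure Mesh (d : ℕ) where
  a : Fin (d + 1) → ℝ
  n : Fin (d + 1) → ℕ
  h : ℝ
  n_pos : ∀ i, 0 < n i
  h_pos : 0 < h

variable {d : ℕ}

/-- An element, labelled by its position in the grid. -/
abbrev Mesh.Elem (𝒯 : Mesh d) : Type := (i : Fin (d + 1)) → Fin (𝒯.n i)

/-- The closed cube belonging to an element. -/
def Mesh.cell (𝒯 : Mesh d) (T : 𝒯.Elem) : Set (Fin (d + 1) → ℝ) :=
  Set.Icc (fun i => 𝒯.a i + (T i : ℕ) * 𝒯.h) (fun i => 𝒯.a i + ((T i : ℕ) + 1) * 𝒯.h)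

/-- A face, given by its normal direction `dir`, the position `pos ∈ {0, …, n dir}` of the grid
hyperplane `x_dir = a_dir + pos * h` that contains it, and its position `tr` in that hyperplane.
These are all interior and all boundary faces, each listed once. -/
structure Mesh.Face (𝒯 : Mesh d) where
  dir : Fin (d + 1)
  pos : Fin (𝒯.n dir + 1)
  tr : (l : Fin d) → Fin (𝒯.n (dir.succAbove l))

/-- Faces as a sigma type, used only to see that there are finitely many. -/
def Mesh.faceEquiv (𝒯 : Mesh d) :
    ((i : Fin (d + 1)) × (Fin (𝒯.n i + 1) × ((l : Fin d) → Fin (𝒯.n (i.succAbove l))))) ≃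
      𝒯.Face where
  toFun x := ⟨x.1, x.2.1, x.2.2⟩
  invFun F := ⟨F.dir, F.pos, F.tr⟩
  left_inv _ := rfl
  right_inv _ := rfl

instance (𝒯 : Mesh d) : Fintype 𝒯.Face := Fintype.ofEquiv _ 𝒯.faceEquiv

/-- The element adjacent to the face on the side of smaller `x_dir`, if it exists. -/
def Mesh.Face.below {𝒯 : Mesh d} (F : 𝒯.Face) : Option 𝒯.Elem :=
  if hF : 0 < (F.pos : ℕ) then
    some (F.dir.insertNth ⟨(F.pos : ℕ) - 1, by have := F.pos.isLt; omega⟩ F.tr)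
  else none

/-- The element adjacent to the face on the side of larger `x_dir`, if it exists. -/
def Mesh.Face.above {𝒯 : Mesh d} (F : 𝒯.Face) : Option 𝒯.Elem :=
  if hF : (F.pos : ℕ) < 𝒯.n F.dir then
    some (F.dir.insertNth ⟨(F.pos : ℕ), hF⟩ F.tr)
  else none

/-- Element-wise functions: on every element a function of its own, which has traces on the faces
of that element. Only the values on (a neighbourhood of) the element matter. -/
abbrev Mesh.Broken (𝒯 : Mesh d) : Type := 𝒯.Elem → (Fin (d + 1) → ℝ) → ℝ

/-- The unit normal of a face: from the element `below` to the element `above` on interior faces,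
outward on boundary faces. -/
def Mesh.Face.normal {𝒯 : Mesh d} (F : 𝒯.Face) : Fin (d + 1) → ℝ :=
  match F.below, F.above with
  | none, _ => -Pi.single F.dir 1
  | some _, _ => Pi.single F.dir 1

/-- The average of a broken function on a face (its trace, on a boundary face).
A face always has a neighbour, so the last case does not occur. -/
def Mesh.Face.avg {𝒯 : Mesh d} (F : 𝒯.Face) (u : 𝒯.Broken) (x : Fin (d + 1) → ℝ) : ℝ :=
  match F.below, F.above with
  | some T₁, some T₂ => (1 / 2) * u T₁ x + (1 / 2) * u T₂ x
  | some T, none => u T x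
  | none, some T => u T x
  | none, none => 0

/-- The jump of a broken function on a face (its trace, on a boundary face).
A face always has a neighbour, so the last case does not occur. -/
def Mesh.Face.jump {𝒯 : Mesh d} (F : 𝒯.Face) (u : 𝒯.Broken) (x : Fin (d + 1) → ℝ) : ℝ :=
  match F.below, F.above with
  | some T₁, some T₂ => u T₁ x - u T₂ x
  | some T, none => u T x
  | none, some T => u T x
  | none, none => 0

/-- The integral over a face with respect to the `d`-dimensional surface measure. -/
def Mesh.Face.integral {𝒯 : Mesh d} (F : 𝒯.Face) (f : (Fin (d + 1) → ℝ) → ℝ) : ℝ :=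
  (∫ y in Set.Icc
      (fun l : Fin d => 𝒯.a (F.dir.succAbove l) + (F.tr l : ℕ) * 𝒯.h)
      (fun l : Fin d => 𝒯.a (F.dir.succAbove l) + ((F.tr l : ℕ) + 1) * 𝒯.h),
    f (F.dir.insertNth (α := fun _ => ℝ) (𝒯.a F.dir + (F.pos : ℕ) * 𝒯.h) y))

/-- The partial derivative `∂_i f`. -/
def partialDeriv (i : Fin (d + 1)) (f : (Fin (d + 1) → ℝ) → ℝ) (x : Fin (d + 1) → ℝ) : ℝ :=
  fderiv ℝ f x (Pi.single i 1)

/-- The average of `∇u · n` on a face. -/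
def Mesh.Face.avgNormalDeriv {𝒯 : Mesh d} (F : 𝒯.Face) (u : 𝒯.Broken) :
    (Fin (d + 1) → ℝ) → ℝ :=
  fun x => ∑ i, F.avg (fun T => partialDeriv i (u T)) x * F.normal i

/-- The symmetric interior penalty form `𝒜_k`, with penalty `α = α₀ k² / h`. -/
def Mesh.form (𝒯 : Mesh d) (α₀ : ℝ) (k : ℕ) (u v : 𝒯.Broken) : ℝ :=
  (∑ T : 𝒯.Elem, (∫ x in 𝒯.cell T, ∑ i, partialDeriv i (u T) x * partialDeriv i (v T) x))
  - (∑ F : 𝒯.Face, F.integral (fun x => F.avgNormalDeriv u x * F.jump v x))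
  - (∑ F : 𝒯.Face, F.integral (fun x => F.avgNormalDeriv v x * F.jump u x))
  + (∑ F : 𝒯.Face, (α₀ * (k : ℝ) ^ 2 / 𝒯.h) * F.integral (fun x => F.jump u x * F.jump v x))

/-- The `L²(Ω)` inner product of broken functions. -/
def Mesh.l2Inner (𝒯 : Mesh d) (u v : 𝒯.Broken) : ℝ :=
  ∑ T : 𝒯.Elem, (∫ x in 𝒯.cell T, u T x * v T x)

/-- Labels `(T, σ)` of the basis functions of the broken space of degree at most `k` in each
variable; there are `N_h * (k + 1) ^ (d + 1)` of them. -/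
abbrev Mesh.Idx (𝒯 : Mesh d) (k : ℕ) : Type := 𝒯.Elem × (Fin (d + 1) → Fin (k + 1))

/-- The tensor product Legendre basis function `Ψ_T^σ`, extended by zero to the other elements. -/
def Mesh.basisFun (𝒯 : Mesh d) {k : ℕ} (j : 𝒯.Idx k) : 𝒯.Broken := fun T x =>
  if T = j.1 then
    ∏ i, (legendre (j.2 i)).eval (2 * (x i - (𝒯.a i + (j.1 i : ℕ) * 𝒯.h)) / 𝒯.h - 1)
  else 0

/-- The stiffness matrix `A_k` in the Legendre basis. -/
def Mesh.stiff (𝒯 : Mesh d) (α₀ : ℝ) (k : ℕ) : Matrix (𝒯.Idx k) (𝒯.Idx k) ℝ :=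
  Matrix.of fun i j => 𝒯.form α₀ k (𝒯.basisFun i) (𝒯.basisFun j)

/-- The mass matrix `M_k` in the Legendre basis. -/
def Mesh.mass (𝒯 : Mesh d) (k : ℕ) : Matrix (𝒯.Idx k) (𝒯.Idx k) ℝ :=
  Matrix.of fun i j => 𝒯.l2Inner (𝒯.basisFun i) (𝒯.basisFun j)

/-- The diagonal part `D_k` of the stiffness matrix. -/
def Mesh.diagStiff (𝒯 : Mesh d) (α₀ : ℝ) (k : ℕ) : Matrix (𝒯.Idx k) (𝒯.Idx k) ℝ :=
  Matrix.diagonal (𝒯.stiff α₀ k).diag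

/-- The polynomials of the fourth-kind Chebyshev iteration: `P_0 = 1`, `P_1 = 1 - 4x/3` and
`P_i = (4i-2)/(2i+1) (1-2x) P_{i-1} - (2i-3)/(2i+1) P_{i-2}` for `i ≥ 2`. -/
def chebP : ℕ → ℝ[X]
  | 0 => 1
  | 1 => 1 - C (4 / 3) * X
  | j + 2 =>
      C ((4 * ((j + 2 : ℕ) : ℝ) - 2) / (2 * ((j + 2 : ℕ) : ℝ) + 1)) * (1 - 2 * X) * chebP (j + 1)
      - C ((2 * ((j + 2 : ℕ) : ℝ) - 3) / (2 * ((j + 2 : ℕ) : ℝ) + 1)) * chebP j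

section Matrices

variable {ι : Type} [Fintype ι] [DecidableEq ι]

/-- The real power `A ^ s` of a symmetric matrix, by the functional calculus. -/
def symPow (A : Matrix ι ι ℝ) (s : ℝ) : Matrix ι ι ℝ := cfc (fun x : ℝ => x ^ s) A

/-- The norm `‖v‖_{A,s} = (vᵀ A^s v)^(1/2)`. -/
def normAs (A : Matrix ι ι ℝ) (s : ℝ) (v : ι → ℝ) : ℝ :=
  √(v ⬝ᵥ (Matrix.mulVec (symPow A s) v))

/-- The spectral radius of a real matrix: the largest modulus of a complex eigenvalue. -/
def specRadius (B : Matrix ι ι ℝ) : ENNReal := spectralRadius ℂ (B.map (algebraMap ℝ ℂ))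

end Matrices

/-- The iteration matrix `P_m(ω D_k⁻¹ A_k)` of the fourth-kind Chebyshev smoother. -/
def Mesh.smoother (𝒯 : Mesh d) (α₀ : ℝ) (k : ℕ) (ω : ℝ) (m : ℕ) :
    Matrix (𝒯.Idx k) (𝒯.Idx k) ℝ :=
  Polynomial.aeval (ω • ((𝒯.diagStiff α₀ k)⁻¹ * 𝒯.stiff α₀ k)) (chebP m)

end IPDG

end

/-! Write `A`, `M` for the stiffness and mass matrices and `D` for the diagonal of `A`. If `D ≤ K
M`, then `M⁻¹ ≤ K D⁻¹`, since Legendre orthogonality makes `M` diagonal. The squared left-hand side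
is therefore at most `K` times the squared Euclidean norm of `S P_m(ωS) z`, where `S = D^(-1/2) A
D^(-1/2)` and `z = D^(1/2) g`. On `[0, 1]` one has `x P_m(x)² ≤ (2m+1)⁻²`, because `P_m` is a
rescaled sine quotient. The condition `ωρ ≤ 1` puts the spectrum of `ωS` in `[0, 1]`, so the squared
norm is at most `K / (ω (2m+1)²)` times the squared energy norm of `g` (`normAs_chebP_le`).

It remains to find `K` of order `k³/h²`; with `ω ≥ c/(k+1)` this gives `k⁴/(h²m²)`. The interior
penalty form of tensor products splits into one-dimensional forms times masses in the other
directions (`Mesh.form_tensor`), so only the one-dimensional diagonal matters. Its entries are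
`O(k²)` (`refStiff_diag_le`), since Legendre polynomials have end values `±1` and the squared norm
of their derivative is only `O(k²)`. The last factor `k/h` comes from the one-dimensional mass
`h/(2s+1) ≥ h/(2k+1)`.

Positive definiteness passes through the same splitting, so it is a one-dimensional statement. It
rests on the sharp trace inequality `eval_sq_le_polyInt` and holds for penalties `α₀ ≥ 5`, whatever
the dimension. -/

namespace IPDG

/-! ### Legendre polynomials and the sharp trace inequality on `[-1, 1]` -/

/-- The integral of a polynomial over `[-1, 1]`. -/
noncomputable def polyInt : ℝ[X] →ₗ[ℝ] ℝ where
  toFun p := ∫ x in (-1 : ℝ)..1, p.eval x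
  map_add' p q := by
    simp only [eval_add]
    exact intervalIntegral.integral_add (p.continuous.intervalIntegrable _ _)
      (q.continuous.intervalIntegrable _ _)
  map_smul' r p := by
    simp only [eval_smul, smul_eq_mul, intervalIntegral.integral_const_mul, RingHom.id_apply]

theorem polyInt_apply (p : ℝ[X]) : polyInt p = ∫ x in (-1 : ℝ)..1, p.eval x := rfl

theorem polyInt_derivative (p : ℝ[X]) : polyInt (derivative p) = p.eval 1 - p.eval (-1) :=
  intervalIntegral.integral_eq_sub_of_hasDerivAt (fun x _ => p.hasDerivAt x)
    ((derivative p).continuous.intervalIntegrable _ _)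

theorem polyInt_mul_self_nonneg (p : ℝ[X]) : 0 ≤ polyInt (p * p) := by
  rw [polyInt_apply]
  apply intervalIntegral.integral_nonneg (by norm_num)
  intro x _
  rw [eval_mul]
  exact mul_self_nonneg _

/-- In the Leibniz rule, a term with fewer than `n` derivatives on `(X - a)^n` keeps a factor
vanishing at `a`. This yields the end values of Rodrigues' formula. -/
theorem eval_iterate_derivative_X_sub_C_pow_mul (a : ℝ) (n : ℕ) (q : ℝ[X]) :
    (derivative^[n] ((X - C a) ^ n * q)).eval a = n.factorial * q.eval a := by
  rw [iterate_derivative_mul, eval_finsetSum, Finset.sum_eq_single 0]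
  · simp [iterate_derivative_X_sub_pow_self]
  · intro j hj hj0
    rw [Finset.mem_range] at hj
    rw [iterate_derivative_X_sub_pow]
    have : n - (n - j) ≠ 0 := by omega
    simp [this]
  · simp

theorem X_sq_sub_one_pow (n : ℕ) :
    ((X : ℝ[X]) ^ 2 - 1) ^ n = (X - C 1) ^ n * (X - C (-1)) ^ n := by
  rw [← mul_pow]; congr 1; simp only [map_neg, map_one]; ring

theorem legendre_eval_one (n : ℕ) : (legendre n).eval 1 = 1 := by
  rw [legendre, X_sq_sub_one_pow, eval_mul, eval_iterate_derivative_X_sub_C_pow_mul]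
  have : (n.factorial : ℝ) ≠ 0 := by positivity
  simp only [eval_C, eval_pow, eval_sub, eval_X]
  norm_num
  field_simp

theorem legendre_eval_neg_one (n : ℕ) : (legendre n).eval (-1) = (-1) ^ n := by
  rw [legendre, X_sq_sub_one_pow, mul_comm ((X - C 1) ^ n), eval_mul,
    eval_iterate_derivative_X_sub_C_pow_mul]
  have : (n.factorial : ℝ) ≠ 0 := by positivity
  simp only [eval_C, eval_pow, eval_sub, eval_X]
  rw [show (-1 - 1 : ℝ) = (-1) * 2 by norm_num, mul_pow]
  field_simp

theorem legendre_eval_sq {n : ℕ} {e : ℝ} (he : e = 1 ∨ e = -1) :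
    (legendre n).eval e ^ 2 = 1 := by
  rcases he with rfl | rfl
  · simp [legendre_eval_one]
  · rw [legendre_eval_neg_one, ← pow_mul, mul_comm, pow_mul]; simp

/-- Repeated integration by parts: each step moves one derivative onto `q`, and the boundary terms
vanish because fewer than `n` derivatives of `(X² - 1)^n` leave a factor `X² - 1`. -/
theorem polyInt_iterate_derivative_mul {n : ℕ} : ∀ {j : ℕ}, j ≤ n → ∀ {q : ℝ[X]}, q.degree < j →
    polyInt (derivative^[j] ((X ^ 2 - 1) ^ n) * q) = 0
  | 0, _, q, hq => by
    have : q = 0 := by simpa using hq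
    simp [this]
  | j + 1, hj, q, hq => by
    have hb : ∀ e : ℝ, e ^ 2 = 1 →
        (derivative^[j] (((X : ℝ[X]) ^ 2 - 1) ^ n)).eval e = 0 := by
      intro e he
      have hd := pow_sub_dvd_iterate_derivative_pow ((X : ℝ[X]) ^ 2 - 1) n j
      obtain ⟨r, hr⟩ := hd
      rw [hr]
      have : n - j ≠ 0 := by omega
      simp [he, this]
    have hdq : (derivative q).degree < j := by
      by_cases h0 : q = 0
      · subst h0; simp [bot_lt_iff_ne_bot]
      · by_cases hd0 : derivative q = 0
        · rw [hd0]; simp [bot_lt_iff_ne_bot]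
        · rw [degree_eq_natDegree h0] at hq
          rw [degree_eq_natDegree hd0]
          have h1 : q.natDegree < j + 1 := by exact_mod_cast hq
          have h2 : q.natDegree ≠ 0 := by
            intro h
            exact hd0 (derivative_of_natDegree_zero h)
          have := natDegree_derivative_lt h2
          exact_mod_cast (by omega : (derivative q).natDegree < j)
    have key : derivative^[j + 1] (((X : ℝ[X]) ^ 2 - 1) ^ n) * q =
        derivative (derivative^[j] ((X ^ 2 - 1) ^ n) * q)
          - derivative^[j] ((X ^ 2 - 1) ^ n) * derivative q := by
      rw [derivative_mul, Function.iterate_succ_apply']; ring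
    rw [key, map_sub, polyInt_derivative, polyInt_iterate_derivative_mul (by omega) hdq]
    simp [hb]

theorem polyInt_legendre_mul_of_degree_lt {n : ℕ} {q : ℝ[X]} (hq : q.degree < n) :
    polyInt (legendre n * q) = 0 := by
  rw [legendre, mul_assoc, ← smul_eq_C_mul, map_smul, polyInt_iterate_derivative_mul le_rfl hq,
    smul_zero]

theorem monic_X_sq_sub_one_pow (n : ℕ) : (((X : ℝ[X]) ^ 2 - 1) ^ n).Monic :=
  (monic_X_pow_sub_C 1 two_ne_zero).pow n

theorem natDegree_X_sq_sub_one_pow (n : ℕ) : (((X : ℝ[X]) ^ 2 - 1) ^ n).natDegree = n + n := by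
  rw [natDegree_pow, show ((X : ℝ[X]) ^ 2 - 1) = X ^ 2 - C 1 by simp, natDegree_X_pow_sub_C]
  ring

theorem natDegree_legendre_le (n : ℕ) : (legendre n).natDegree ≤ n := by
  refine (natDegree_C_mul_le _ _).trans ((natDegree_iterate_derivative _ _).trans ?_)
  rw [natDegree_X_sq_sub_one_pow]; omega

theorem legendre_coeff_ne_zero (n : ℕ) : (legendre n).coeff n ≠ 0 := by
  rw [legendre, coeff_C_mul, coeff_iterate_derivative]
  have h : (((X : ℝ[X]) ^ 2 - 1) ^ n).coeff (n + n) = 1 := by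
    rw [← natDegree_X_sq_sub_one_pow n]
    exact monic_X_sq_sub_one_pow n
  rw [h]
  have : (n + n).descFactorial n ≠ 0 := by
    rw [Ne, Nat.descFactorial_eq_zero_iff_lt]; omega
  simp [this, Nat.factorial_ne_zero]

theorem degree_legendre_le (n : ℕ) : (legendre n).degree ≤ n :=
  natDegree_le_iff_degree_le.mp (natDegree_legendre_le n)

/-- Integrate `(x l²)' = l² + 2 l · x l'`. Since `x l' - n l` has degree below `n`, it is orthogonal
to `l`, and the boundary terms sum to `2`. -/
theorem polyInt_legendre_sq (n : ℕ) : polyInt (legendre n * legendre n) = 2 / (2 * n + 1) := by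
  set l := legendre n with hl
  have hdeg : (X * derivative l - C (n : ℝ) * l).degree < (n : WithBot ℕ) := by
    rw [degree_lt_iff_coeff_zero]
    intro m hm
    rcases m with _ | m
    · have : n = 0 := by omega
      simp [this]
    · rw [coeff_sub, coeff_X_mul, coeff_C_mul, coeff_derivative]
      rcases eq_or_lt_of_le hm with h | h
      · rw [h]; push_cast; ring
      · have : l.coeff (m + 1) = 0 :=
          coeff_eq_zero_of_natDegree_lt (lt_of_le_of_lt (natDegree_legendre_le n) h)
        simp [this]
  have h0 := polyInt_legendre_mul_of_degree_lt hdeg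
  have h1 : derivative (X * (l * l)) =
      (1 + 2 * (n : ℝ)) • (l * l) + (2 : ℝ) • (l * (X * derivative l - C (n : ℝ) * l)) := by
    simp only [derivative_mul, derivative_X, smul_eq_C_mul, map_add, map_mul, map_one]
    rw [show (C 2 : ℝ[X]) = 2 from rfl]
    ring
  have h2 := polyInt_derivative (X * (l * l))
  rw [h1, map_add, map_smul, map_smul, h0] at h2
  have e1 : l.eval 1 ^ 2 = 1 := legendre_eval_sq (Or.inl rfl)
  have e2 : l.eval (-1) ^ 2 = 1 := legendre_eval_sq (Or.inr rfl)
  simp only [eval_mul, eval_X, smul_eq_mul] at h2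
  have : (2 * (n : ℝ) + 1) ≠ 0 := by positivity
  rw [eq_div_iff this]
  linarith

theorem polyInt_legendre_mul_legendre (m n : ℕ) :
    polyInt (legendre m * legendre n) = if m = n then 2 / (2 * (n : ℝ) + 1) else 0 := by
  split_ifs with h
  · rw [h, polyInt_legendre_sq]
  · rcases lt_or_gt_of_ne h with h | h
    · rw [mul_comm]
      exact polyInt_legendre_mul_of_degree_lt
        (lt_of_le_of_lt (degree_legendre_le m) (by exact_mod_cast h))
    · exact polyInt_legendre_mul_of_degree_lt
        (lt_of_le_of_lt (degree_legendre_le n) (by exact_mod_cast h))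

/-- The trace inverse inequality in one dimension. -/
theorem eval_sq_le_polyInt {e : ℝ} (he : e = 1 ∨ e = -1) : ∀ {N : ℕ} {p : ℝ[X]}, p.degree < N →
    p.eval e ^ 2 ≤ (N : ℝ) ^ 2 / 2 * polyInt (p * p)
  | 0, p, hp => by
    have : p = 0 := by simpa using hp
    simp [this]
  | N + 1, p, hp => by
    set l := legendre N with hl
    -- Splitting off the top Legendre component leaves an orthogonal remainder of lower degree. The
    -- induction accumulates the constant `∑ (2j+1)/2` over `j < N`, which is `N²/2`.
    obtain ⟨c, hc⟩ : ∃ c : ℝ, (p - c • l).degree < N := by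
      refine ⟨p.coeff N / l.coeff N, ?_⟩
      rw [degree_lt_iff_coeff_zero]
      intro m hm
      rw [coeff_sub, coeff_smul, smul_eq_mul]
      rcases eq_or_lt_of_le hm with h | h
      · have := legendre_coeff_ne_zero N
        rw [← h, div_mul_cancel₀ _ this, sub_self]
      · rw [coeff_eq_zero_of_natDegree_lt (lt_of_le_of_lt (natDegree_legendre_le N) h),
          coeff_eq_zero_of_degree_lt (lt_of_lt_of_le hp (by exact_mod_cast h))]
        simp
    set r := p - c • l with hr
    have hpr : p = c • l + r := by rw [hr]; abel
    have ih := eval_sq_le_polyInt he hc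
    have hlr : polyInt (l * r) = 0 := polyInt_legendre_mul_of_degree_lt hc
    have hI : polyInt (p * p) = c ^ 2 * (2 / (2 * N + 1)) + polyInt (r * r) := by
      have : p * p = (c ^ 2) • (l * l) + (2 * c) • (l * r) + r * r := by
        rw [hpr]; simp only [smul_eq_C_mul, map_mul, map_pow]
        rw [show (C 2 : ℝ[X]) = 2 from rfl]; ring
      rw [this, map_add, map_add, map_smul, map_smul, hlr, hl, polyInt_legendre_sq]
      simp
    have hev : p.eval e = c * l.eval e + r.eval e := by
      conv_lhs => rw [hpr]
      simp
    have hle : l.eval e ^ 2 = 1 := legendre_eval_sq he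
    have hR := polyInt_mul_self_nonneg r
    rw [hI, hev]
    set a := c * l.eval e with ha
    set b := r.eval e
    set R := polyInt (r * r)
    have hca : c ^ 2 = a ^ 2 := by rw [ha, mul_pow, hle, mul_one]
    rw [hca]
    set n : ℝ := (N : ℝ)
    have hn : 0 ≤ n := Nat.cast_nonneg N
    have hk : (0 : ℝ) < 2 * n + 1 := by positivity
    push_cast
    -- Young's inequality, weighted so that the two terms are exactly those left over when `(n+1)² =
    -- n² + (2n+1)` is expanded in the target.
    have hcross : 2 * (a * b) ≤ a ^ 2 * n ^ 2 / (2 * n + 1) + (2 * n + 1) * (R / 2) := by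
      set u := a ^ 2 * n ^ 2 / (2 * n + 1) with hu
      set w := (2 * n + 1) * (R / 2) with hw
      have hu0 : 0 ≤ u := by positivity
      have hw0 : 0 ≤ w := by positivity
      have huw : u * w = a ^ 2 * (n ^ 2 / 2 * R) := by rw [hu, hw]; field_simp
      have : (a * b) ^ 2 ≤ u * w := by
        rw [huw, mul_pow]
        exact mul_le_mul_of_nonneg_left ih (sq_nonneg a)
      apply le_of_sq_le_sq _ (by positivity)
      nlinarith [sq_nonneg (u - w)]
    have hexp : (n + 1) ^ 2 / 2 * (a ^ 2 * (2 / (2 * n + 1)) + R) =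
        a ^ 2 + a ^ 2 * n ^ 2 / (2 * n + 1) + (2 * n + 1) * (R / 2) + n ^ 2 / 2 * R := by
      field_simp; ring
    rw [hexp]
    nlinarith

/-! ### Fourth-kind Chebyshev polynomials -/

/-- After multiplication by `(2m+1) sin φ`, the recurrence becomes the addition formula for
`sin((2m+1)φ ± 2φ)`, with `1 - 2 sin² φ = cos 2φ`. -/
theorem chebP_eval_sin_sq (φ : ℝ) : ∀ m : ℕ,
    (2 * (m : ℝ) + 1) * Real.sin φ * (chebP m).eval (Real.sin φ ^ 2) =
      Real.sin ((2 * (m : ℝ) + 1) * φ)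
  | 0 => by simp [chebP]
  | 1 => by
    have h : (2 * ((1 : ℕ) : ℝ) + 1) * φ = 3 * φ := by norm_num
    rw [h, Real.sin_three_mul]
    simp only [chebP, eval_sub, eval_one, eval_mul, eval_C, eval_X]
    push_cast; ring
  | m + 2 => by
    have h1 := chebP_eval_sin_sq φ (m + 1)
    have h0 := chebP_eval_sin_sq φ m
    have hs : Real.sin ((2 * ((m + 2 : ℕ) : ℝ) + 1) * φ) =
        2 * (1 - 2 * Real.sin φ ^ 2) * Real.sin ((2 * ((m + 1 : ℕ) : ℝ) + 1) * φ)
          - Real.sin ((2 * (m : ℝ) + 1) * φ) := by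
      rw [show (2 * ((m + 2 : ℕ) : ℝ) + 1) * φ = (2 * ((m + 1 : ℕ) : ℝ) + 1) * φ + 2 * φ by
          push_cast; ring,
        show (2 * (m : ℝ) + 1) * φ = (2 * ((m + 1 : ℕ) : ℝ) + 1) * φ - 2 * φ by
          push_cast; ring, Real.sin_add, Real.sin_sub, Real.cos_two_mul, Real.cos_sq']
      ring
    rw [hs, ← h1, ← h0]
    simp only [chebP, eval_sub, eval_mul, eval_C, eval_one, eval_X, eval_ofNat]
    have : (2 * ((m + 2 : ℕ) : ℝ) + 1) ≠ 0 := by positivity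
    field_simp
    push_cast
    ring

theorem mul_chebP_eval_sq_le (m : ℕ) {x : ℝ} (h0 : 0 ≤ x) (h1 : x ≤ 1) :
    x * (chebP m).eval x ^ 2 ≤ 1 / (2 * (m : ℝ) + 1) ^ 2 := by
  have hs : Real.sin (Real.arcsin √x) = √x :=
    Real.sin_arcsin (by linarith [Real.sqrt_nonneg x]) (Real.sqrt_le_one.mpr h1)
  have h := chebP_eval_sin_sq (Real.arcsin √x) m
  rw [hs, Real.sq_sqrt h0] at h
  rw [le_div_iff₀ (by positivity)]
  calc x * (chebP m).eval x ^ 2 * (2 * (m : ℝ) + 1) ^ 2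
      = ((2 * (m : ℝ) + 1) * √x * (chebP m).eval x) ^ 2 := by
        rw [mul_pow, mul_pow, Real.sq_sqrt h0]; ring
    _ ≤ 1 := by rw [h]; exact Real.sin_sq_le_one _

/-! ### Functional calculus and the abstract smoothing estimate -/

section Matrices

variable {ι : Type} [Fintype ι] [DecidableEq ι]

theorem symPow_zero {A : Matrix ι ι ℝ} (hA : A.IsHermitian) : symPow A 0 = 1 := by
  have : IsSelfAdjoint A := hA
  simp only [symPow, Real.rpow_zero]
  exact cfc_const_one ℝ A

theorem symPow_one {A : Matrix ι ι ℝ} (hA : A.IsHermitian) : symPow A 1 = A := by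
  have : IsSelfAdjoint A := hA
  simp only [symPow, Real.rpow_one]
  exact cfc_id' ℝ A

theorem normAs_zero {A : Matrix ι ι ℝ} (hA : A.IsHermitian) (v : ι → ℝ) :
    normAs A 0 v = √(v ⬝ᵥ v) := by
  rw [normAs, symPow_zero hA, Matrix.one_mulVec]

theorem normAs_one {A : Matrix ι ι ℝ} (hA : A.IsHermitian) (v : ι → ℝ) :
    normAs A 1 v = √(v ⬝ᵥ A.mulVec v) := by
  rw [normAs, symPow_one hA]

theorem isHermitian_symPow (A : Matrix ι ι ℝ) (s : ℝ) : (symPow A s).IsHermitian :=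
  cfc_predicate (R := ℝ) (p := IsSelfAdjoint) (fun x : ℝ => x ^ s) A

theorem symPow_neg_half_mul_self {A : Matrix ι ι ℝ} (hA : A.PosDef) :
    symPow A (-(1 / 2)) * symPow A (-(1 / 2)) = A⁻¹ := by
  have hsa : IsSelfAdjoint A := hA.isHermitian
  have hc : ∀ f : ℝ → ℝ, ContinuousOn f (spectrum ℝ A) := fun f =>
    (Matrix.finite_real_spectrum (A := A)).continuousOn f
  have h1 : symPow A (-(1 / 2)) * symPow A (-(1 / 2)) * A = 1 := by
    have h2 : symPow A (-(1 / 2)) * symPow A (-(1 / 2)) * A =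
        cfc (fun x : ℝ => x ^ (-(1 / 2) : ℝ) * x ^ (-(1 / 2) : ℝ) * x) A := by
      rw [cfc_mul _ _ A (hc _) (hc _), cfc_mul _ _ A (hc _) (hc _), cfc_id' ℝ A]
      rfl
    rw [h2, ← cfc_const_one ℝ A]
    apply cfc_congr
    intro x hx
    have hx0 : 0 < x := by
      rw [hA.isHermitian.spectrum_real_eq_range_eigenvalues] at hx
      obtain ⟨i, rfl⟩ := hx
      exact hA.eigenvalues_pos i
    simp only
    rw [← Real.rpow_add hx0]
    norm_num
    rw [Real.rpow_neg_one, inv_mul_cancel₀ hx0.ne']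
  exact (Matrix.inv_eq_left_inv h1).symm

/-- A real spectral value stays one over `ℂ`, since the determinant commutes with the embedding of
scalars; its modulus is thus bounded by the spectral radius. -/
theorem ofReal_mul_le_one_of_mem_spectrum {B : Matrix ι ι ℝ} {ω : ℝ} (hω : 0 < ω)
    (hρ : ENNReal.ofReal ω * specRadius B ≤ 1) {l : ℝ} (hl : l ∈ spectrum ℝ B) : ω * l ≤ 1 := by
  have hc : (l : ℂ) ∈ spectrum ℂ (B.map (algebraMap ℝ ℂ)) := by
    rw [spectrum.mem_iff] at hl ⊢
    intro h
    apply hl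
    have e : algebraMap ℂ (Matrix ι ι ℂ) (l : ℂ) - B.map (algebraMap ℝ ℂ) =
        (algebraMap ℝ ℂ).mapMatrix (algebraMap ℝ (Matrix ι ι ℝ) l - B) := by
      ext i j
      simp [Matrix.algebraMap_matrix_apply, apply_ite]
    rw [e, Matrix.isUnit_iff_isUnit_det, ← RingHom.map_det] at h
    rw [Matrix.isUnit_iff_isUnit_det]
    simpa using h
  have h1 : ENNReal.ofReal |l| ≤ specRadius B := by
    have : (‖(l : ℂ)‖₊ : ENNReal) ≤ specRadius B :=
      le_iSup₂ (f := fun k (_ : k ∈ spectrum ℂ (B.map (algebraMap ℝ ℂ))) => (‖k‖₊ : ENNReal))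
        (l : ℂ) hc
    rwa [← enorm_eq_nnnorm, ← ofReal_norm, Complex.norm_real, Real.norm_eq_abs] at this
  have h2 : ENNReal.ofReal (ω * |l|) ≤ 1 := by
    rw [ENNReal.ofReal_mul hω.le]
    exact (mul_le_mul_right h1 _).trans hρ
  rw [ENNReal.ofReal_le_one] at h2
  exact (mul_le_mul_of_nonneg_left (le_abs_self l) hω.le).trans h2

open scoped MatrixOrder in
theorem posSemidef_aeval_of_nonneg {S : Matrix ι ι ℝ} (hS : S.IsHermitian) (q : ℝ[X])
    (hq : ∀ x ∈ spectrum ℝ S, 0 ≤ q.eval x) : (aeval S q).PosSemidef := by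
  have : IsSelfAdjoint S := hS
  rw [← cfc_polynomial (R := ℝ) q S, ← Matrix.nonneg_iff_posSemidef]
  exact cfc_nonneg hq

omit [DecidableEq ι] in
theorem mulVec_dotProduct_mulVec_self {B : Matrix ι ι ℝ} (hB : B.IsHermitian) (v : ι → ℝ) :
    B.mulVec v ⬝ᵥ B.mulVec v = v ⬝ᵥ (B * B).mulVec v := by
  have hBt : B.transpose = B := hB
  rw [← Matrix.mulVec_mulVec, Matrix.dotProduct_mulVec v, ← Matrix.mulVec_transpose, hBt]

theorem isHermitian_aeval {S : Matrix ι ι ℝ} (hS : S.IsHermitian) (q : ℝ[X]) :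
    (aeval S q).IsHermitian := by
  have : IsSelfAdjoint S := hS
  rw [← cfc_polynomial (R := ℝ) q S]
  exact cfc_predicate (R := ℝ) (p := IsSelfAdjoint) _ S

/-- Transfers the Chebyshev polynomial from the non-symmetric `D⁻¹A` to its symmetrisation. -/
theorem aeval_mul_of_semiconj {E S B : Matrix ι ι ℝ} (h : E * B = S * E) (p : ℝ[X]) :
    E * aeval B p = aeval S p * E := by
  induction p using Polynomial.induction_on' with
  | add p q hp hq => rw [map_add, map_add, mul_add, add_mul, hp, hq]
  | monomial n a =>
    have : SemiconjBy E B S := h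
    rw [aeval_monomial, aeval_monomial, ← mul_assoc, ← Algebra.commutes, mul_assoc,
      (this.pow_right n).eq, mul_assoc]

/-- The smoothing property of the fourth-kind Chebyshev iteration for a symmetric matrix. -/
theorem mulVec_chebP_dotProduct_le {S : Matrix ι ι ℝ} (hS : S.PosSemidef) {ω : ℝ} (hω : 0 < ω)
    (hs : ∀ x ∈ spectrum ℝ S, ω * x ≤ 1) (m : ℕ) (z : ι → ℝ) :
    (S * aeval (ω • S) (chebP m)).mulVec z ⬝ᵥ (S * aeval (ω • S) (chebP m)).mulVec z ≤
      1 / (ω * (2 * (m : ℝ) + 1) ^ 2) * (z ⬝ᵥ S.mulVec z) := by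
  set P := (chebP m).comp (C ω * X) with hP
  have hPS : aeval (ω • S) (chebP m) = aeval S P := by
    rw [hP, aeval_comp, map_mul, aeval_C, aeval_X, Algebra.smul_def]
  have hSP : S * aeval (ω • S) (chebP m) = aeval S (X * P) := by
    rw [hPS, map_mul, aeval_X]
  set K := 1 / (ω * (2 * (m : ℝ) + 1) ^ 2) with hK
  -- The claim is the scalar inequality `(x P(x))² ≤ K x` on the spectrum, which is the sine bound
  -- at `ωx` divided by `ω` and multiplied by `x`.
  have hps := posSemidef_aeval_of_nonneg hS.isHermitian (C K * X - X * P * (X * P)) (by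
    intro x hx
    have hx0 : 0 ≤ x := by
      rw [hS.isHermitian.spectrum_real_eq_range_eigenvalues] at hx
      obtain ⟨i, rfl⟩ := hx
      exact hS.eigenvalues_nonneg i
    have h := mul_chebP_eval_sq_le m (mul_nonneg hω.le hx0) (hs x hx)
    simp only [eval_sub, eval_mul, eval_C, eval_X, hP, eval_comp]
    have h2 : x * (x * (ω * x * (chebP m).eval (ω * x) ^ 2)) ≤
        x * (x * (1 / (2 * (m : ℝ) + 1) ^ 2)) := by gcongr
    have h3 : x * (chebP m).eval (ω * x) ^ 2 ≤ K := by
      rw [hK, one_div, mul_inv, ← div_eq_inv_mul, ← one_div, le_div_iff₀' hω]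
      linarith
    nlinarith)
  have h := hps.dotProduct_mulVec_nonneg z
  rw [star_trivial, map_sub, map_mul, map_mul (aeval S) (X * P), aeval_C, aeval_X,
    Matrix.sub_mulVec, dotProduct_sub, ← Algebra.smul_def, Matrix.smul_mulVec,
    dotProduct_smul, smul_eq_mul, ← mulVec_dotProduct_mulVec_self
      (isHermitian_aeval hS.isHermitian _)] at h
  rw [hSP]
  linarith

/-- Conjugation by `E = D^(1/2)`, with inverse `F`, turns `D⁻¹A` into the symmetric `S = FAF`. The
comparison `D ≤ K M` is used only to replace `M⁻¹` by `K D⁻¹`. -/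
theorem normAs_chebP_le {A M : Matrix ι ι ℝ} (hA : A.PosDef) {μ : ι → ℝ}
    (hM : M = Matrix.diagonal μ) (hμ : ∀ i, 0 < μ i) {K : ℝ}
    (hK : ∀ i, A i i ≤ K * μ i) {ω : ℝ} (hω : 0 < ω)
    (hρ : ENNReal.ofReal ω * specRadius ((Matrix.diagonal A.diag)⁻¹ * A) ≤ 1) (m : ℕ)
    (g : ι → ℝ) :
    normAs A 0 ((symPow M (-(1 / 2)) * A *
        aeval (ω • ((Matrix.diagonal A.diag)⁻¹ * A)) (chebP m)).mulVec g) ≤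
      √(K * (1 / (ω * (2 * (m : ℝ) + 1) ^ 2))) * normAs A 1 g := by
  have hD : ∀ i, 0 < A i i := fun i => hA.diag_pos
  have hMpd : M.PosDef := by rw [hM]; exact Matrix.PosDef.diagonal hμ
  set F : Matrix ι ι ℝ := Matrix.diagonal fun i => (√(A i i))⁻¹ with hF
  set E : Matrix ι ι ℝ := Matrix.diagonal fun i => √(A i i) with hE
  have hsq : ∀ i, √(A i i) ≠ 0 := fun i => (Real.sqrt_pos.mpr (hD i)).ne'
  have hFE : F * E = 1 := by
    rw [hF, hE, Matrix.diagonal_mul_diagonal, ← Matrix.diagonal_one]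
    congr 1; ext i; exact inv_mul_cancel₀ (hsq i)
  have hEF : E * F = 1 := by
    rw [hF, hE, Matrix.diagonal_mul_diagonal, ← Matrix.diagonal_one]
    congr 1; ext i; exact mul_inv_cancel₀ (hsq i)
  have hFF : (Matrix.diagonal A.diag)⁻¹ = F * F := by
    apply Matrix.inv_eq_left_inv
    rw [hF, Matrix.diagonal_mul_diagonal, Matrix.diagonal_mul_diagonal, ← Matrix.diagonal_one]
    congr 1; ext i
    rw [Matrix.diag_apply, ← mul_inv, Real.mul_self_sqrt (hD i).le, inv_mul_cancel₀ (hD i).ne']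
  have hFh : F.IsHermitian := Matrix.isHermitian_diagonal _
  set S := F * A * F with hSdef
  have hS : S.PosSemidef := by
    have := hA.posSemidef.mul_mul_conjTranspose_same F
    rwa [hFh] at this
  rw [hFF] at hρ ⊢
  set R := A * aeval (ω • (F * F * A)) (chebP m) with hR
  have hFR : F * R = S * aeval (ω • S) (chebP m) * E := by
    have h := aeval_mul_of_semiconj (E := E) (B := ω • (F * F * A)) (S := ω • S) (by
      rw [mul_smul_comm, smul_mul_assoc, hSdef, mul_assoc (F * A), hFE, mul_one, ← mul_assoc,
        ← mul_assoc, hEF, one_mul]) (chebP m)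
    rw [mul_assoc S, ← h, hR, hSdef, ← mul_assoc, mul_assoc (F * A), ← mul_assoc F E, hFE,
      one_mul]
  have hspec : ∀ x ∈ spectrum ℝ S, ω * x ≤ 1 := by
    intro x hx
    -- `(FA)F` and `F(FA) = D⁻¹A` have the same nonzero spectrum, and zero satisfies the bound
    -- trivially.
    by_cases hx0 : x = 0
    · simp [hx0]
    · apply ofReal_mul_le_one_of_mem_spectrum hω hρ
      have h := spectrum.nonzero_mul_comm (𝕜 := ℝ) (F * A) F
      have h2 : x ∈ spectrum ℝ (F * A * F) \ {0} := ⟨hx, hx0⟩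
      rw [h, ← mul_assoc] at h2
      exact h2.1
  have hmain := mulVec_chebP_dotProduct_le hS hω hspec m (E.mulVec g)
  rw [Matrix.mulVec_mulVec, ← hFR] at hmain
  have hzz : E.mulVec g ⬝ᵥ S.mulVec (E.mulVec g) = g ⬝ᵥ A.mulVec g := by
    have hEt : E.transpose = E := Matrix.diagonal_transpose _
    rw [Matrix.mulVec_mulVec, ← hEt, Matrix.mulVec_transpose, hEt, ← Matrix.dotProduct_mulVec,
      Matrix.mulVec_mulVec, hSdef, ← mul_assoc, ← mul_assoc, ← mul_assoc, hEF, one_mul, mul_assoc,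
      hFE, mul_one]
  rw [hzz] at hmain
  rw [normAs_zero hA.isHermitian, normAs_one hA.isHermitian]
  have hg : 0 ≤ g ⬝ᵥ A.mulVec g := by simpa using hA.posSemidef.dotProduct_mulVec_nonneg g
  rw [mul_assoc, ← hR, ← Matrix.mulVec_mulVec,
    mulVec_dotProduct_mulVec_self (isHermitian_symPow M _), symPow_neg_half_mul_self hMpd]
  set r := R.mulVec g with hr
  have hMinv : M⁻¹ = Matrix.diagonal fun i => (μ i)⁻¹ := by
    apply Matrix.inv_eq_left_inv
    rw [hM, Matrix.diagonal_mul_diagonal, ← Matrix.diagonal_one]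
    congr 1; ext i; exact inv_mul_cancel₀ (hμ i).ne'
  have hle : r ⬝ᵥ M⁻¹.mulVec r ≤ K * ((F * R).mulVec g ⬝ᵥ (F * R).mulVec g) := by
    rw [← Matrix.mulVec_mulVec, ← hr, hMinv, hF]
    simp only [dotProduct, Matrix.mulVec_diagonal, Finset.mul_sum]
    refine Finset.sum_le_sum fun i _ => ?_
    have h1 : (μ i)⁻¹ ≤ K * (A i i)⁻¹ := by
      rw [inv_le_iff_one_le_mul₀ (hμ i), mul_right_comm, ← div_eq_mul_inv, le_div_iff₀ (hD i),
        one_mul]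
      exact hK i
    have h2 : (√(A i i))⁻¹ * (√(A i i))⁻¹ = (A i i)⁻¹ := by
      rw [← mul_inv, Real.mul_self_sqrt (hD i).le]
    calc r i * ((μ i)⁻¹ * r i) = (μ i)⁻¹ * r i ^ 2 := by ring
      _ ≤ K * (A i i)⁻¹ * r i ^ 2 := by gcongr
      _ = K * ((√(A i i))⁻¹ * r i * ((√(A i i))⁻¹ * r i)) := by rw [← h2]; ring
  -- An index is needed to deduce `0 ≤ K` from `hK`; without one both sides vanish.
  by_cases hne : Nonempty ι
  · have hK0 : 0 ≤ K := by
      obtain ⟨i⟩ := hne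
      by_contra hneg
      have := hK i
      nlinarith [hD i, hμ i]
    rw [← Real.sqrt_mul (by positivity)]
    apply Real.sqrt_le_sqrt
    calc _ ≤ _ := hle
      _ ≤ K * (1 / (ω * (2 * (m : ℝ) + 1) ^ 2) * (g ⬝ᵥ A.mulVec g)) := by gcongr
      _ = _ := by ring
  · rw [not_nonempty_iff] at hne
    simp [dotProduct]

end Matrices

/-! ### The one-dimensional interior penalty form in reference coordinates -/

section OneDim

variable {n : ℕ}

/-- The trace at an interface, from the cell on its left, of a piecewise polynomial given in
reference coordinates; zero at the left end point. -/
noncomputable def traceLo (f : Fin (n + 1)) : (Fin n → ℝ[X]) →ₗ[ℝ] ℝ :=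
  if hf : 0 < (f : ℕ) then
    leval 1 ∘ₗ LinearMap.proj (⟨(f : ℕ) - 1, by have := f.isLt; omega⟩ : Fin n)
  else 0

/-- The trace at an interface, from the cell on its right; zero at the right end point. -/
noncomputable def traceHi (f : Fin (n + 1)) : (Fin n → ℝ[X]) →ₗ[ℝ] ℝ :=
  if hf : (f : ℕ) < n then leval (-1) ∘ₗ LinearMap.proj (⟨(f : ℕ), hf⟩ : Fin n) else 0

theorem traceLo_zero (P : Fin n → ℝ[X]) : traceLo 0 P = 0 := by simp [traceLo]

theorem traceLo_succ (t : Fin n) (P : Fin n → ℝ[X]) : traceLo t.succ P = (P t).eval 1 := by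
  simp [traceLo, leval]

theorem traceHi_last (P : Fin n → ℝ[X]) : traceHi (Fin.last n) P = 0 := by simp [traceHi]

theorem traceHi_castSucc (t : Fin n) (P : Fin n → ℝ[X]) :
    traceHi t.castSucc P = (P t).eval (-1) := by
  simp [traceHi, leval]

theorem sum_traceLo_sq (P : Fin n → ℝ[X]) :
    ∑ f, traceLo f P ^ 2 = ∑ t, (P t).eval 1 ^ 2 := by
  simp [Fin.sum_univ_succ, traceLo_zero, traceLo_succ]

theorem sum_traceHi_sq (P : Fin n → ℝ[X]) :
    ∑ f, traceHi f P ^ 2 = ∑ t, (P t).eval (-1) ^ 2 := by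
  simp [Fin.sum_univ_castSucc, traceHi_last, traceHi_castSucc]

/-- The weight of the average: `1 / 2` at interior interfaces, `1` at the end points. -/
noncomputable def avgWeight (f : Fin (n + 1)) : ℝ :=
  if 0 < (f : ℕ) ∧ (f : ℕ) < n then 1 / 2 else 1

/-- The jump at an interface. -/
noncomputable def jumpRef (f : Fin (n + 1)) : (Fin n → ℝ[X]) →ₗ[ℝ] ℝ := traceLo f - traceHi f

/-- The average of the derivative at an interface. -/
noncomputable def avgDerivRef (f : Fin (n + 1)) : (Fin n → ℝ[X]) →ₗ[ℝ] ℝ :=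
  avgWeight f • ((traceLo f + traceHi f) ∘ₗ LinearMap.compLeft derivative (Fin n))

theorem jumpRef_apply (f : Fin (n + 1)) (P : Fin n → ℝ[X]) :
    jumpRef f P = traceLo f P - traceHi f P := rfl

theorem avgDerivRef_apply (f : Fin (n + 1)) (P : Fin n → ℝ[X]) :
    avgDerivRef f P = avgWeight f *
      (traceLo f (fun t => derivative (P t)) + traceHi f (fun t => derivative (P t))) := rfl

/-- The one-dimensional interior penalty form in reference coordinates. -/
noncomputable def refForm (n : ℕ) (β : ℝ) : LinearMap.BilinForm ℝ (Fin n → ℝ[X]) :=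
  LinearMap.mk₂ ℝ (fun P Q =>
    -- These are the physical terms with `h⁻¹` factored out: differentiation gives `2/h` and
    -- integration over a cell `h/2`, so gradient and flux terms carry a `2` and the penalty term
    -- does not.
    2 * ∑ t, polyInt (derivative (P t) * derivative (Q t))
      - 2 * ∑ f, avgDerivRef f P * jumpRef f Q - 2 * ∑ f, avgDerivRef f Q * jumpRef f P
      + β * ∑ f, jumpRef f P * jumpRef f Q)
    (by intro P P' Q; simp only [Pi.add_apply, map_add, add_mul, mul_add, Finset.sum_add_distrib]
        ring)
    (by intro c P Q
        simp only [Pi.smul_apply, map_smul, smul_mul_assoc, mul_smul_comm, ← Finset.smul_sum]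
        simp only [smul_eq_mul]
        ring)
    (by intro P Q Q'; simp only [Pi.add_apply, map_add, add_mul, mul_add, Finset.sum_add_distrib]
        ring)
    (by intro c P Q
        simp only [Pi.smul_apply, map_smul, smul_mul_assoc, mul_smul_comm, ← Finset.smul_sum]
        simp only [smul_eq_mul]
        ring)

theorem refForm_apply (β : ℝ) (P Q : Fin n → ℝ[X]) : refForm n β P Q =
    2 * ∑ t, polyInt (derivative (P t) * derivative (Q t))
      - 2 * ∑ f, avgDerivRef f P * jumpRef f Q - 2 * ∑ f, avgDerivRef f Q * jumpRef f P
      + β * ∑ f, jumpRef f P * jumpRef f Q := rfl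

theorem refForm_comm (β : ℝ) (P Q : Fin n → ℝ[X]) : refForm n β P Q = refForm n β Q P := by
  simp only [refForm_apply, mul_comm (jumpRef _ P) (jumpRef _ Q),
    mul_comm (derivative (P _)) (derivative (Q _))]
  ring

theorem degree_derivative_lt_of_degree_lt {p : ℝ[X]} {k : ℕ}
    (hp : p.degree < ((k + 1 : ℕ) : WithBot ℕ)) : (derivative p).degree < (k : WithBot ℕ) := by
  rw [degree_lt_iff_coeff_zero] at hp ⊢
  intro m hm
  rw [coeff_derivative, hp (m + 1) (by omega), zero_mul]

/-- Each cell contributes two end point traces of a derivative of degree at most `k - 1`, each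
costing `k²/2` by the trace inequality. -/
theorem sum_avgDerivRef_sq_le {k : ℕ} {P : Fin n → ℝ[X]}
    (hP : ∀ t, (P t).degree < ((k + 1 : ℕ) : WithBot ℕ)) :
    ∑ f, avgDerivRef f P ^ 2 ≤
      (k : ℝ) ^ 2 * ∑ t, polyInt (derivative (P t) * derivative (P t)) := by
  have h1 : ∀ f, avgDerivRef f P ^ 2 ≤ traceLo f (fun t => derivative (P t)) ^ 2
      + traceHi f (fun t => derivative (P t)) ^ 2 := by
    intro f
    rw [avgDerivRef_apply, avgWeight]
    split_ifs with h
    · nlinarith [sq_nonneg (traceLo f (fun t => derivative (P t))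
        - traceHi f (fun t => derivative (P t))), sq_nonneg (traceLo f (fun t => derivative (P t))
        + traceHi f (fun t => derivative (P t)))]
    · rw [not_and_or] at h
      rcases h with h | h
      · rw [show traceLo f = 0 from dif_neg h]; simp
      · rw [show traceHi f = 0 from dif_neg h]; simp
  refine (Finset.sum_le_sum fun f _ => h1 f).trans ?_
  rw [Finset.sum_add_distrib, sum_traceLo_sq, sum_traceHi_sq, ← Finset.sum_add_distrib,
    Finset.mul_sum]
  refine Finset.sum_le_sum fun t _ => ?_
  have a := eval_sq_le_polyInt (Or.inl rfl) (degree_derivative_lt_of_degree_lt (hP t))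
  have b := eval_sq_le_polyInt (Or.inr rfl) (degree_derivative_lt_of_degree_lt (hP t))
  linarith

/-- Young's inequality with weight `k⁻²` on the flux, so that the previous bound turns the flux into
a single copy of the gradient term. -/
theorem abs_sum_avgDerivRef_mul_jumpRef_le {k : ℕ} (hk : 1 ≤ k) {P : Fin n → ℝ[X]}
    (hP : ∀ t, (P t).degree < ((k + 1 : ℕ) : WithBot ℕ)) :
    |4 * ∑ f, avgDerivRef f P * jumpRef f P| ≤
      ∑ t, polyInt (derivative (P t) * derivative (P t))
        + 4 * (k : ℝ) ^ 2 * ∑ f, jumpRef f P ^ 2 := by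
  have hk0 : (0 : ℝ) < k := by exact_mod_cast hk
  have h1 : ∀ f, |4 * (avgDerivRef f P * jumpRef f P)| ≤
      ((k : ℝ) ^ 2)⁻¹ * avgDerivRef f P ^ 2 + 4 * (k : ℝ) ^ 2 * jumpRef f P ^ 2 := by
    intro f
    set x := avgDerivRef f P
    set y := jumpRef f P
    have e1 : ((k : ℝ) ^ 2)⁻¹ * x ^ 2 + 4 * (k : ℝ) ^ 2 * y ^ 2 =
      (x / k - 2 * k * y) ^ 2 + 4 * (x * y) := by field_simp; ring
    have e2 : ((k : ℝ) ^ 2)⁻¹ * x ^ 2 + 4 * (k : ℝ) ^ 2 * y ^ 2 =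
      (x / k + 2 * k * y) ^ 2 - 4 * (x * y) := by field_simp; ring
    rw [abs_le]
    constructor
    · nlinarith [sq_nonneg (x / k + 2 * k * y)]
    · nlinarith [sq_nonneg (x / k - 2 * k * y)]
  rw [Finset.mul_sum]
  refine (Finset.abs_sum_le_sum_abs _ _).trans ((Finset.sum_le_sum fun f _ => h1 f).trans ?_)
  rw [Finset.sum_add_distrib, ← Finset.mul_sum, ← Finset.mul_sum]
  gcongr
  rw [inv_mul_le_iff₀ (by positivity)]
  exact sum_avgDerivRef_sq_le hP

/-- The consistency terms cost one of the two gradient copies and `4k²` of the penalty; the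
threshold `5` leaves one copy of each. -/
theorem le_refForm_self {k : ℕ} (hk : 1 ≤ k) {α₀ : ℝ} (hα : 5 ≤ α₀) {P : Fin n → ℝ[X]}
    (hP : ∀ t, (P t).degree < ((k + 1 : ℕ) : WithBot ℕ)) :
    ∑ t, polyInt (derivative (P t) * derivative (P t)) + (k : ℝ) ^ 2 * ∑ f, jumpRef f P ^ 2 ≤
      refForm n (α₀ * (k : ℝ) ^ 2) P P := by
  have h := (abs_le.mp (abs_sum_avgDerivRef_mul_jumpRef_le hk hP)).2
  rw [refForm_apply]
  simp only [← sq (jumpRef _ P)]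
  have hJ : 0 ≤ (k : ℝ) ^ 2 * ∑ f, jumpRef f P ^ 2 := by positivity
  nlinarith

theorem refForm_self_le {k : ℕ} (hk : 1 ≤ k) {α₀ : ℝ} (hα : 0 ≤ α₀) {P : Fin n → ℝ[X]}
    (hP : ∀ t, (P t).degree < ((k + 1 : ℕ) : WithBot ℕ)) :
    refForm n (α₀ * (k : ℝ) ^ 2) P P ≤
      3 * ∑ t, polyInt (derivative (P t) * derivative (P t))
        + (2 * α₀ + 8) * (k : ℝ) ^ 2 * ∑ t, ((P t).eval 1 ^ 2 + (P t).eval (-1) ^ 2) := by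
  have h := (abs_le.mp (abs_sum_avgDerivRef_mul_jumpRef_le hk hP)).1
  rw [refForm_apply]
  simp only [← sq (jumpRef _ P)]
  have hJ : ∑ f, jumpRef f P ^ 2 ≤ 2 * ∑ t, ((P t).eval 1 ^ 2 + (P t).eval (-1) ^ 2) := by
    rw [Finset.sum_add_distrib, ← sum_traceLo_sq, ← sum_traceHi_sq, ← Finset.sum_add_distrib,
      Finset.mul_sum]
    refine Finset.sum_le_sum fun f _ => ?_
    rw [jumpRef_apply]
    nlinarith [sq_nonneg (traceLo f P + traceHi f P)]
  have hJ2 := mul_le_mul_of_nonneg_left hJ (by positivity : 0 ≤ (α₀ + 4) * (k : ℝ) ^ 2)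
  nlinarith

theorem eq_zero_of_polyInt_mul_self_eq_zero {p : ℝ[X]} (h : polyInt (p * p) = 0) : p = 0 := by
  apply eq_zero_of_infinite_isRoot
  refine (Set.Icc_infinite (by norm_num : (-1 : ℝ) < 1)).mono fun c hc => ?_
  by_contra hne
  refine h.not_gt (intervalIntegral.integral_pos (by norm_num) (p * p).continuous.continuousOn
    (fun x _ => ?_) ⟨c, hc, ?_⟩)
  · rw [eval_mul]; exact mul_self_nonneg _
  · rw [eval_mul]; exact mul_self_pos.mpr hne

theorem eq_zero_of_refForm_self_nonpos {k : ℕ} (hk : 1 ≤ k) {α₀ : ℝ} (hα : 5 ≤ α₀)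
    {P : Fin n → ℝ[X]} (hP : ∀ t, (P t).degree < ((k + 1 : ℕ) : WithBot ℕ))
    (h : refForm n (α₀ * (k : ℝ) ^ 2) P P ≤ 0) : P = 0 := by
  have hk0 : (0 : ℝ) < k := by exact_mod_cast hk
  have hle := (le_refForm_self hk hα hP).trans h
  have hS : 0 ≤ ∑ t, polyInt (derivative (P t) * derivative (P t)) :=
    Finset.sum_nonneg fun t _ => polyInt_mul_self_nonneg _
  have hJ : 0 ≤ ∑ f, jumpRef f P ^ 2 := by positivity
  have hS0 : ∑ t, polyInt (derivative (P t) * derivative (P t)) = 0 := by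
    nlinarith [mul_nonneg (sq_nonneg (k : ℝ)) hJ]
  have hJ0 : ∑ f, jumpRef f P ^ 2 = 0 := by
    have : (k : ℝ) ^ 2 * ∑ f, jumpRef f P ^ 2 ≤ 0 := by linarith
    nlinarith [sq_pos_of_pos hk0]
  have hd : ∀ t, derivative (P t) = 0 := fun t =>
    eq_zero_of_polyInt_mul_self_eq_zero (
      (Finset.sum_eq_zero_iff_of_nonneg fun t _ => polyInt_mul_self_nonneg _).mp hS0 t
        (Finset.mem_univ t))
  have hj : ∀ f, jumpRef f P = 0 := fun f =>
    pow_eq_zero_iff two_ne_zero |>.mp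
      ((Finset.sum_eq_zero_iff_of_nonneg fun f _ => sq_nonneg _).mp hJ0 f (Finset.mem_univ f))
  have hconst : ∀ t, ∃ c : ℝ, P t = C c := fun t => ⟨_, eq_C_of_derivative_eq_zero (hd t)⟩
  -- The pieces are constant. The jump at the left end point is a trace, which annihilates the first
  -- piece; vanishing interior jumps carry zero to the right.
  have hall : ∀ m : ℕ, ∀ hm : m < n, P ⟨m, hm⟩ = 0 := by
    intro m
    induction m with
    | zero =>
      intro hm
      obtain ⟨c, hc⟩ := hconst ⟨0, hm⟩
      have := hj (Fin.castSucc ⟨0, hm⟩)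
      rw [jumpRef_apply, traceHi_castSucc, hc] at this
      simp [traceLo] at this
      rw [hc, this, C_0]
    | succ m ih =>
      intro hm
      obtain ⟨c, hc⟩ := hconst ⟨m + 1, hm⟩
      have := hj (Fin.castSucc ⟨m + 1, hm⟩)
      rw [jumpRef_apply, traceHi_castSucc, hc] at this
      simp [traceLo, leval, ih (by omega)] at this
      rw [hc, this, C_0]
  exact funext fun t => hall t t.isLt

/-- The one-dimensional Legendre basis in reference coordinates. -/
noncomputable def refBasis {k : ℕ} (j : Fin n × Fin (k + 1)) : Fin n → ℝ[X] :=
  Pi.single j.1 (legendre j.2)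

theorem degree_refBasis_lt {k : ℕ} (j : Fin n × Fin (k + 1)) (t : Fin n) :
    (refBasis j t).degree < ((k + 1 : ℕ) : WithBot ℕ) := by
  rw [refBasis, Pi.single_apply]
  split_ifs
  · exact lt_of_le_of_lt (degree_legendre_le _) (by exact_mod_cast j.2.isLt)
  · simp [bot_lt_iff_ne_bot]

/-- The `L²` inner product of piecewise polynomials in reference coordinates. -/
noncomputable def refMass (P Q : Fin n → ℝ[X]) : ℝ := ∑ t, polyInt (P t * Q t)

theorem refMass_refBasis {k : ℕ} (i j : Fin n × Fin (k + 1)) :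
    refMass (refBasis i) (refBasis j) = if i = j then 2 / (2 * ((j.2 : ℕ) : ℝ) + 1) else 0 := by
  obtain ⟨t, s⟩ := i
  obtain ⟨t', s'⟩ := j
  rw [refMass, Finset.sum_eq_single t']
  · simp only [refBasis, Pi.single_apply, if_true]
    by_cases h : t' = t
    · subst h
      simp only [if_true, polyInt_legendre_mul_legendre, Prod.mk.injEq, true_and, Fin.ext_iff]
    · have h' : ¬ (t = t') := fun e => h e.symm
      simp [h, h']
  · intro b _ hb
    simp [refBasis, hb]
  · simp

/-- The Gram matrix of the one-dimensional form in the Legendre basis. -/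
noncomputable def refStiff (n k : ℕ) (β : ℝ) :
    Matrix (Fin n × Fin (k + 1)) (Fin n × Fin (k + 1)) ℝ :=
  Matrix.of fun i j => refForm n β (refBasis i) (refBasis j)

theorem posDef_refStiff {k : ℕ} (hk : 1 ≤ k) {α₀ : ℝ} (hα : 5 ≤ α₀) :
    (refStiff n k (α₀ * (k : ℝ) ^ 2)).PosDef := by
  refine Matrix.PosDef.of_dotProduct_mulVec_pos ?_ ?_
  · ext i j
    exact refForm_comm _ _ _
  · intro v hv
    set P : Fin n → ℝ[X] := ∑ j, v j • refBasis j with hPdef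
    have hval : star v ⬝ᵥ (refStiff n k (α₀ * (k : ℝ) ^ 2)).mulVec v =
        refForm n (α₀ * (k : ℝ) ^ 2) P P := by
      rw [hPdef, star_trivial]
      simp only [map_sum, LinearMap.sum_apply, map_smul, LinearMap.smul_apply, dotProduct,
        Matrix.mulVec, refStiff, Matrix.of_apply, smul_eq_mul, Finset.mul_sum]
      rw [Finset.sum_comm]
      refine Finset.sum_congr rfl fun i _ => Finset.sum_congr rfl fun j _ => ?_
      ring
    rw [hval]
    by_contra hneg
    have hP0 := eq_zero_of_refForm_self_nonpos hk hα (P := P) (fun t => by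
      rw [hPdef, Finset.sum_apply]
      refine (degree_sum_le _ _).trans_lt ?_
      rw [Finset.sup_lt_iff (by simp [bot_lt_iff_ne_bot])]
      intro j _
      exact (degree_smul_le _ _).trans_lt (degree_refBasis_lt j t)) (not_lt.mp hneg)
    apply hv
    ext i
    -- Coefficients are recovered by testing against the orthogonal Legendre basis.
    have h0 : refMass (refBasis i) P = 0 := by rw [hP0]; simp [refMass]
    have h1 : refMass (refBasis i) P = ∑ j, v j * refMass (refBasis i) (refBasis j) := by
      simp only [refMass, hPdef, Finset.sum_apply, Pi.smul_apply, Finset.mul_sum, map_sum,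
        mul_smul_comm, map_smul, smul_eq_mul]
      exact Finset.sum_comm
    rw [h1] at h0
    simp only [refMass_refBasis, mul_ite, mul_zero, Finset.sum_ite_eq, Finset.mem_univ,
      if_true] at h0
    have : (2 * ((i.2 : ℕ) : ℝ) + 1) ≠ 0 := by positivity
    simpa [this] using h0

/-- As `l` is orthogonal to `l''`, integration by parts leaves `I = [l l']` with `l(±1)² = 1`. The
trace inequality for `l'` then gives `I² ≤ 2k² I`. A general polynomial of degree `k` would only
allow a bound of order `k⁴`. -/
theorem polyInt_derivative_legendre_sq_le {s k : ℕ} (hs : s ≤ k) :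
    polyInt (derivative (legendre s) * derivative (legendre s)) ≤ 2 * (k : ℝ) ^ 2 := by
  set l := legendre s with hl
  set I := polyInt (derivative l * derivative l) with hI
  have hdeg : l.degree < ((k + 1 : ℕ) : WithBot ℕ) :=
    lt_of_le_of_lt (degree_legendre_le s) (by exact_mod_cast Nat.lt_succ_of_le hs)
  have h2 : polyInt (l * derivative (derivative l)) = 0 := by
    apply polyInt_legendre_mul_of_degree_lt
    have h1 : l.degree < ((s + 1 : ℕ) : WithBot ℕ) :=
      lt_of_le_of_lt (degree_legendre_le s) (by exact_mod_cast Nat.lt_succ_self s)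
    exact (degree_derivative_le).trans_lt (degree_derivative_lt_of_degree_lt h1)
  have h3 := polyInt_derivative (l * derivative l)
  rw [derivative_mul, map_add, h2, add_zero, ← hI, eval_mul, eval_mul] at h3
  have a := eval_sq_le_polyInt (Or.inl rfl) (degree_derivative_lt_of_degree_lt hdeg)
  have b := eval_sq_le_polyInt (Or.inr rfl) (degree_derivative_lt_of_degree_lt hdeg)
  rw [← hI] at a b
  have e1 : l.eval 1 ^ 2 = 1 := legendre_eval_sq (Or.inl rfl)
  have e2 : l.eval (-1) ^ 2 = 1 := legendre_eval_sq (Or.inr rfl)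
  set x := (derivative l).eval 1
  set y := (derivative l).eval (-1)
  set u := l.eval 1
  set w := l.eval (-1)
  have hI0 : 0 ≤ I := polyInt_mul_self_nonneg _
  have h4 : I ^ 2 ≤ 2 * (k : ℝ) ^ 2 * I := by
    have e3 : (u * x) ^ 2 = x ^ 2 := by rw [mul_pow, e1, one_mul]
    have e4 : (w * y) ^ 2 = y ^ 2 := by rw [mul_pow, e2, one_mul]
    rw [h3]
    nlinarith [sq_nonneg (u * x + w * y)]
  rcases hI0.eq_or_lt with h | h
  · rw [← h]; positivity
  · nlinarith

/-- The constant is `3 · 2` from the gradient plus `2 (2α₀ + 8)` from the two unit end values. -/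
theorem refStiff_diag_le {k : ℕ} (hk : 1 ≤ k) {α₀ : ℝ} (hα : 0 ≤ α₀)
    (j : Fin n × Fin (k + 1)) :
    refStiff n k (α₀ * (k : ℝ) ^ 2) j j ≤ (4 * α₀ + 22) * (k : ℝ) ^ 2 := by
  obtain ⟨t, s⟩ := j
  have h := refForm_self_le hk hα (degree_refBasis_lt (t, s))
  have h1 : ∑ t', polyInt (derivative (refBasis (t, s) t') * derivative (refBasis (t, s) t')) =
      polyInt (derivative (legendre s) * derivative (legendre s)) := by
    rw [Finset.sum_eq_single t]
    · simp [refBasis]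
    · intro b _ hb; simp [refBasis, hb]
    · simp
  have h2 : ∑ t', ((refBasis (t, s) t').eval 1 ^ 2 + (refBasis (t, s) t').eval (-1) ^ 2) = 2 := by
    rw [Finset.sum_eq_single t]
    · simp only [refBasis, Pi.single_eq_same]
      rw [legendre_eval_sq (Or.inl rfl), legendre_eval_sq (Or.inr rfl)]
      norm_num
    · intro b _ hb; simp [refBasis, hb]
    · simp
  rw [h1, h2] at h
  have h3 := polyInt_derivative_legendre_sq_le (Nat.lt_succ_iff.mp s.isLt)
  rw [refStiff, Matrix.of_apply]
  linarith

end OneDim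

/-! ### Tensor products: separation of the cell integrals -/

variable {d : ℕ}

/-- The affine map of the interval of the mesh with label `t` in direction `i` to `[-1, 1]`. -/
noncomputable def Mesh.refCoord (𝒯 : Mesh d) (i : Fin (d + 1)) (t : Fin (𝒯.n i)) (x : ℝ) : ℝ :=
  2 * (x - (𝒯.a i + (t : ℕ) * 𝒯.h)) / 𝒯.h - 1

/-- The tensor product of one-dimensional piecewise polynomials. -/
noncomputable def Mesh.tensor (𝒯 : Mesh d) (p : (i : Fin (d + 1)) → Fin (𝒯.n i) → ℝ[X]) :
    𝒯.Broken :=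
  fun T x => ∏ i, (p i (T i)).eval (𝒯.refCoord i (T i) (x i))

theorem Mesh.basisFun_eq_tensor (𝒯 : Mesh d) {k : ℕ} (j : 𝒯.Idx k) :
    𝒯.basisFun j = 𝒯.tensor fun i => refBasis (j.1 i, j.2 i) := by
  ext T x
  rw [Mesh.basisFun, Mesh.tensor]
  split_ifs with h
  · subst h
    simp [refBasis, Mesh.refCoord]
  · obtain ⟨i, hi⟩ := Function.ne_iff.mp h
    rw [Finset.prod_eq_zero (Finset.mem_univ i)]
    simp [refBasis, Pi.single_eq_of_ne hi]

/-- The tensor product over all directions but `i`. -/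
noncomputable def Mesh.tensorTr (𝒯 : Mesh d) (i : Fin (d + 1))
    (p : (i : Fin (d + 1)) → Fin (𝒯.n i) → ℝ[X]) (T : (l : Fin d) → Fin (𝒯.n (i.succAbove l)))
    (y : Fin d → ℝ) : ℝ :=
  ∏ l, (p (i.succAbove l) (T l)).eval (𝒯.refCoord (i.succAbove l) (T l) (y l))

theorem Mesh.tensor_eq_mul (𝒯 : Mesh d) (p : (i : Fin (d + 1)) → Fin (𝒯.n i) → ℝ[X])
    (i : Fin (d + 1)) (T : 𝒯.Elem) (x : Fin (d + 1) → ℝ) :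
    𝒯.tensor p T x = (p i (T i)).eval (𝒯.refCoord i (T i) (x i)) *
      𝒯.tensorTr i p (i.removeNth T) (i.removeNth x) :=
  Fin.prod_univ_succAbove _ i

theorem Mesh.continuous_refCoord (𝒯 : Mesh d) (i : Fin (d + 1)) (t : Fin (𝒯.n i)) :
    Continuous (𝒯.refCoord i t) := by
  unfold Mesh.refCoord; fun_prop

theorem Mesh.hasDerivAt_refCoord (𝒯 : Mesh d) (i : Fin (d + 1)) (t : Fin (𝒯.n i)) (x : ℝ) :
    HasDerivAt (𝒯.refCoord i t) (2 / 𝒯.h) x := by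
  unfold Mesh.refCoord
  have := ((((hasDerivAt_id x).sub_const (𝒯.a i + (t : ℕ) * 𝒯.h)).const_mul 2).div_const
    𝒯.h).sub_const 1
  simpa using this

theorem Mesh.continuous_tensor (𝒯 : Mesh d) (p : (i : Fin (d + 1)) → Fin (𝒯.n i) → ℝ[X])
    (T : 𝒯.Elem) : Continuous (𝒯.tensor p T) := by
  unfold Mesh.tensor
  refine continuous_finsetProd _ fun i _ => ?_
  exact (p i (T i)).continuous.comp ((𝒯.continuous_refCoord i (T i)).comp (continuous_apply i))

theorem Mesh.differentiable_tensor (𝒯 : Mesh d) (p : (i : Fin (d + 1)) → Fin (𝒯.n i) → ℝ[X])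
    (T : 𝒯.Elem) : Differentiable ℝ (𝒯.tensor p T) := by
  unfold Mesh.tensor
  have h1 : ∀ i, Differentiable ℝ (𝒯.refCoord i (T i)) := fun i x =>
    (𝒯.hasDerivAt_refCoord i (T i) x).differentiableAt
  have h2 : ∀ i, Differentiable ℝ fun x : Fin (d + 1) → ℝ =>
      (p i (T i)).eval (𝒯.refCoord i (T i) (x i)) := fun i =>
    (p i (T i)).differentiable.comp ((h1 i).comp (differentiable_apply i))
  fun_prop

theorem Mesh.partialDeriv_tensor (𝒯 : Mesh d) (p : (i : Fin (d + 1)) → Fin (𝒯.n i) → ℝ[X])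
    (T : 𝒯.Elem) (i : Fin (d + 1)) (x : Fin (d + 1) → ℝ) :
    partialDeriv i (𝒯.tensor p T) x =
      2 / 𝒯.h * ((derivative (p i (T i))).eval (𝒯.refCoord i (T i) (x i)) *
        𝒯.tensorTr i p (i.removeNth T) (i.removeNth x)) := by
  rw [partialDeriv, ← (𝒯.differentiable_tensor p T x).lineDeriv_eq_fderiv]
  apply HasLineDerivAt.lineDeriv
  rw [HasLineDerivAt]
  have hr : ∀ s : ℝ, i.removeNth (x + s • (Pi.single i 1 : Fin (d + 1) → ℝ)) = i.removeNth x := by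
    intro s
    ext l
    simp [Fin.removeNth]
  simp only [𝒯.tensor_eq_mul p i, hr]
  have h1 : HasDerivAt (fun s : ℝ => (x + s • (Pi.single i 1 : Fin (d + 1) → ℝ)) i) 1 0 := by
    simpa using (hasDerivAt_id (0 : ℝ)).const_add (x i)
  have h2 := (𝒯.hasDerivAt_refCoord i (T i)
    ((x + (0 : ℝ) • (Pi.single i 1 : Fin (d + 1) → ℝ)) i)).comp (0 : ℝ) h1
  have h3 := ((p i (T i)).hasDerivAt (𝒯.refCoord i (T i)
    ((x + (0 : ℝ) • (Pi.single i 1 : Fin (d + 1) → ℝ)) i))).comp (0 : ℝ) h2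
  have h4 := h3.mul_const (𝒯.tensorTr i p (i.removeNth T) (i.removeNth x))
  refine h4.congr_deriv ?_
  simp
  ring

theorem Mesh.setIntegral_refCoord (𝒯 : Mesh d) (i : Fin (d + 1)) (t : Fin (𝒯.n i)) (p : ℝ[X]) :
    ∫ x in Set.Icc (𝒯.a i + (t : ℕ) * 𝒯.h) (𝒯.a i + ((t : ℕ) + 1) * 𝒯.h),
      p.eval (𝒯.refCoord i t x) = 𝒯.h / 2 * polyInt p := by
  have hh := 𝒯.h_pos
  rw [integral_Icc_eq_integral_Ioc, ← intervalIntegral.integral_of_le (by nlinarith)]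
  have he : ∀ x, 𝒯.refCoord i t x =
      2 / 𝒯.h * x - (2 * (𝒯.a i + (t : ℕ) * 𝒯.h) / 𝒯.h + 1) := by
    intro x; rw [Mesh.refCoord]; ring
  simp only [he]
  rw [intervalIntegral.integral_comp_mul_sub (fun y => p.eval y) (by positivity), polyInt_apply,
    smul_eq_mul, inv_div]
  congr 2 <;> (field_simp; ring)

/-- The map `e` selects the directions, so that one Fubini argument serves cells (`e = id`) and
faces (`e = i.succAbove`). -/
theorem Mesh.setIntegral_prod (𝒯 : Mesh d) {m : ℕ} (e : Fin m → Fin (d + 1))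
    (T : (l : Fin m) → Fin (𝒯.n (e l))) (p : Fin m → ℝ[X]) :
    ∫ y in Set.Icc (fun l => 𝒯.a (e l) + (T l : ℕ) * 𝒯.h)
        (fun l => 𝒯.a (e l) + ((T l : ℕ) + 1) * 𝒯.h),
      ∏ l, (p l).eval (𝒯.refCoord (e l) (T l) (y l)) = ∏ l, (𝒯.h / 2 * polyInt (p l)) := by
  rw [← Set.pi_univ_Icc, volume_pi, Measure.restrict_pi_pi,
    integral_fintype_prod_eq_prod (fun l x => (p l).eval (𝒯.refCoord (e l) (T l) x))]
  exact Finset.prod_congr rfl fun l _ => 𝒯.setIntegral_refCoord (e l) (T l) (p l)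

/-- The product of the one-dimensional mass terms over all directions but `i`. -/
noncomputable def Mesh.massTr (𝒯 : Mesh d) (i : Fin (d + 1))
    (p q : (i : Fin (d + 1)) → Fin (𝒯.n i) → ℝ[X]) : ℝ :=
  ∏ l, (𝒯.h / 2 * refMass (p (i.succAbove l)) (q (i.succAbove l)))

theorem Mesh.sum_prod_polyInt (𝒯 : Mesh d) {m : ℕ} (e : Fin m → Fin (d + 1))
    (p q : (l : Fin m) → Fin (𝒯.n (e l)) → ℝ[X]) :
    ∑ T : (l : Fin m) → Fin (𝒯.n (e l)), ∏ l, (𝒯.h / 2 * polyInt (p l (T l) * q l (T l))) =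
      ∏ l, (𝒯.h / 2 * refMass (p l) (q l)) := by
  simp only [refMass, Finset.mul_sum]
  rw [Finset.prod_univ_sum, Fintype.piFinset_univ]

theorem Mesh.setIntegral_tensorTr (𝒯 : Mesh d) (i : Fin (d + 1))
    (p q : (i : Fin (d + 1)) → Fin (𝒯.n i) → ℝ[X])
    (T : (l : Fin d) → Fin (𝒯.n (i.succAbove l))) :
    ∫ y in Set.Icc (fun l : Fin d => 𝒯.a (i.succAbove l) + (T l : ℕ) * 𝒯.h)
        (fun l : Fin d => 𝒯.a (i.succAbove l) + ((T l : ℕ) + 1) * 𝒯.h),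
      𝒯.tensorTr i p T y * 𝒯.tensorTr i q T y =
        ∏ l, (𝒯.h / 2 * polyInt (p (i.succAbove l) (T l) * q (i.succAbove l) (T l))) := by
  rw [← 𝒯.setIntegral_prod i.succAbove T]
  simp only [Mesh.tensorTr, ← Finset.prod_mul_distrib, ← eval_mul]

theorem Mesh.l2Inner_tensor (𝒯 : Mesh d) (p q : (i : Fin (d + 1)) → Fin (𝒯.n i) → ℝ[X]) :
    𝒯.l2Inner (𝒯.tensor p) (𝒯.tensor q) = ∏ i, (𝒯.h / 2 * refMass (p i) (q i)) := by
  rw [← 𝒯.sum_prod_polyInt id, Mesh.l2Inner]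
  refine Finset.sum_congr rfl fun T _ => ?_
  rw [← 𝒯.setIntegral_prod id T]
  simp only [Mesh.tensor, ← Finset.prod_mul_distrib, ← eval_mul, id, Mesh.cell]

theorem Mesh.sum_elem_eq (𝒯 : Mesh d) (i : Fin (d + 1)) (f : 𝒯.Elem → ℝ) :
    ∑ T, f T = ∑ t : Fin (𝒯.n i), ∑ T' : (l : Fin d) → Fin (𝒯.n (i.succAbove l)),
      f (i.insertNth t T') := by
  rw [← Fintype.sum_prod_type' (f := fun t T' => f (i.insertNth t T'))]
  exact (Fintype.sum_equiv (Fin.insertNthEquiv (fun i => Fin (𝒯.n i)) i) _ _ fun _ => rfl).symm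

theorem Mesh.sum_integral_gradient_tensor (𝒯 : Mesh d)
    (p q : (i : Fin (d + 1)) → Fin (𝒯.n i) → ℝ[X]) :
    ∑ T : 𝒯.Elem, (∫ x in 𝒯.cell T,
        ∑ i, partialDeriv i (𝒯.tensor p T) x * partialDeriv i (𝒯.tensor q T) x) =
      ∑ i, 2 / 𝒯.h * (∑ t, polyInt (derivative (p i t) * derivative (q i t))) *
        𝒯.massTr i p q := by
  have hh := 𝒯.h_pos
  -- A partial derivative of a tensor product is again one, with a single factor differentiated and
  -- a scale `2 / h`.
  have hupd : ∀ (p : (i : Fin (d + 1)) → Fin (𝒯.n i) → ℝ[X]) (T : 𝒯.Elem) (i : Fin (d + 1)),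
      partialDeriv i (𝒯.tensor p T) = fun x => 2 / 𝒯.h *
        𝒯.tensor (Function.update p i fun t => derivative (p i t)) T x := by
    intro p T i
    ext x
    rw [𝒯.partialDeriv_tensor, 𝒯.tensor_eq_mul _ i]
    simp [Mesh.tensorTr]
  have hint : ∀ T : 𝒯.Elem, (∫ x in 𝒯.cell T,
        ∑ i, partialDeriv i (𝒯.tensor p T) x * partialDeriv i (𝒯.tensor q T) x) =
      ∑ i, 2 / 𝒯.h * polyInt (derivative (p i (T i)) * derivative (q i (T i))) *
        ∏ l, (𝒯.h / 2 * polyInt (p (i.succAbove l) (T (i.succAbove l)) *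
          q (i.succAbove l) (T (i.succAbove l)))) := by
    intro T
    rw [integral_finsetSum]
    · refine Finset.sum_congr rfl fun i _ => ?_
      simp only [hupd]
      have h1 := 𝒯.setIntegral_prod id T fun j =>
        (Function.update p i fun t => derivative (p i t)) j (T j) *
          (Function.update q i fun t => derivative (q i t)) j (T j)
      rw [Fin.prod_univ_succAbove _ i] at h1
      simp only [Function.update_self, ne_eq, Fin.succAbove_ne, not_false_eq_true,
        Function.update_of_ne, id] at h1
      have h2 : ∀ x, 2 / 𝒯.h * 𝒯.tensor (Function.update p i fun t => derivative (p i t)) T x *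
          (2 / 𝒯.h * 𝒯.tensor (Function.update q i fun t => derivative (q i t)) T x) =
          (2 / 𝒯.h) ^ 2 * ∏ j, ((Function.update p i fun t => derivative (p i t)) j (T j) *
            (Function.update q i fun t => derivative (q i t)) j (T j)).eval
              (𝒯.refCoord j (T j) (x j)) := by
        intro x
        simp only [Mesh.tensor, eval_mul, Finset.prod_mul_distrib]
        ring
      simp only [h2]
      rw [integral_const_mul, Mesh.cell, h1]
      field_simp
    · intro i _
      simp only [hupd]
      apply Continuous.integrableOn_Icc
      exact (continuous_const.mul (𝒯.continuous_tensor _ T)).mul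
        (continuous_const.mul (𝒯.continuous_tensor _ T))
  simp only [hint]
  rw [Finset.sum_comm]
  refine Finset.sum_congr rfl fun i _ => ?_
  rw [𝒯.sum_elem_eq i]
  simp only [Fin.insertNth_apply_same, Fin.insertNth_apply_succAbove]
  rw [Mesh.massTr, ← 𝒯.sum_prod_polyInt i.succAbove (fun l => p (i.succAbove l))
    (fun l => q (i.succAbove l))]
  simp only [← Finset.mul_sum, ← Finset.sum_mul]

/-! ### Face terms and separation of the form -/

/-- The sign relating the jump and the normal of a face to the coordinate direction. -/
noncomputable def Mesh.Face.sgn {𝒯 : Mesh d} (F : 𝒯.Face) : ℝ := if 0 < (F.pos : ℕ) then 1 else -1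

theorem Mesh.Face.sgn_mul_self {𝒯 : Mesh d} (F : 𝒯.Face) : F.sgn * F.sgn = 1 := by
  rw [Mesh.Face.sgn]; split_ifs <;> norm_num

/-- The point of the hyperplane of a face with given tangential coordinates. -/
noncomputable def Mesh.Face.point {𝒯 : Mesh d} (F : 𝒯.Face) (y : Fin d → ℝ) : Fin (d + 1) → ℝ :=
  F.dir.insertNth (α := fun _ => ℝ) (𝒯.a F.dir + (F.pos : ℕ) * 𝒯.h) y

/-- On a left boundary face the jump is the inner trace, whereas `jumpRef` gives its negative; `sgn`
corrects this. The outward normal carries the same sign, so it cancels in every product under a face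
integral. -/
theorem Mesh.Face.jump_eq {𝒯 : Mesh d} (F : 𝒯.Face) {u : 𝒯.Broken} {x : Fin (d + 1) → ℝ}
    {P : Fin (𝒯.n F.dir) → ℝ[X]} {z : ℝ}
    (hlo : ∀ t : Fin (𝒯.n F.dir), (t : ℕ) + 1 = F.pos →
      u (F.dir.insertNth t F.tr) x = (P t).eval 1 * z)
    (hhi : ∀ t : Fin (𝒯.n F.dir), (t : ℕ) = F.pos →
      u (F.dir.insertNth t F.tr) x = (P t).eval (-1) * z) :
    F.jump u x = F.sgn * (jumpRef F.pos P * z) := by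
  have hlt := F.pos.isLt
  have hn := 𝒯.n_pos F.dir
  by_cases h1 : 0 < (F.pos : ℕ)
  · have e1 := hlo ⟨(F.pos : ℕ) - 1, by omega⟩ (Nat.sub_add_cancel h1)
    by_cases h2 : (F.pos : ℕ) < 𝒯.n F.dir
    · have e2 := hhi ⟨F.pos, h2⟩ rfl
      simp only [Mesh.Face.jump, Mesh.Face.below, Mesh.Face.above, h1, h2, dif_pos, e1, e2,
        jumpRef_apply, traceLo, traceHi, Mesh.Face.sgn, if_true, LinearMap.comp_apply,
        LinearMap.proj_apply, leval_apply]
      ring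
    · simp only [Mesh.Face.jump, Mesh.Face.below, Mesh.Face.above, h1, h2, dif_pos, e1,
        jumpRef_apply, traceLo, traceHi, Mesh.Face.sgn, if_true, LinearMap.comp_apply,
        LinearMap.proj_apply, leval_apply, dif_neg, not_false_eq_true, LinearMap.zero_apply]
      ring
  · have h2 : (F.pos : ℕ) < 𝒯.n F.dir := by omega
    have e2 := hhi ⟨F.pos, h2⟩ rfl
    simp only [Mesh.Face.jump, Mesh.Face.below, Mesh.Face.above, h1, h2, dif_pos, e2,
      jumpRef_apply, traceLo, traceHi, Mesh.Face.sgn, if_false, LinearMap.comp_apply,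
      LinearMap.proj_apply, leval_apply, dif_neg, not_false_eq_true, LinearMap.zero_apply]
    ring

theorem Mesh.Face.avg_eq {𝒯 : Mesh d} (F : 𝒯.Face) {u : 𝒯.Broken} {x : Fin (d + 1) → ℝ}
    {P : Fin (𝒯.n F.dir) → ℝ[X]} {z : ℝ}
    (hlo : ∀ t : Fin (𝒯.n F.dir), (t : ℕ) + 1 = F.pos →
      u (F.dir.insertNth t F.tr) x = (P t).eval 1 * z)
    (hhi : ∀ t : Fin (𝒯.n F.dir), (t : ℕ) = F.pos →
      u (F.dir.insertNth t F.tr) x = (P t).eval (-1) * z) :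
    F.avg u x = avgWeight F.pos * (traceLo F.pos P + traceHi F.pos P) * z := by
  have hlt := F.pos.isLt
  have hn := 𝒯.n_pos F.dir
  by_cases h1 : 0 < (F.pos : ℕ)
  · have e1 := hlo ⟨(F.pos : ℕ) - 1, by omega⟩ (Nat.sub_add_cancel h1)
    by_cases h2 : (F.pos : ℕ) < 𝒯.n F.dir
    · have e2 := hhi ⟨F.pos, h2⟩ rfl
      simp only [Mesh.Face.avg, Mesh.Face.below, Mesh.Face.above, h1, h2, dif_pos, e1, e2,
        traceLo, traceHi, avgWeight, and_self, if_true, LinearMap.comp_apply,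
        LinearMap.proj_apply, leval_apply]
      ring
    · simp only [Mesh.Face.avg, Mesh.Face.below, Mesh.Face.above, h1, h2, dif_pos, e1,
        traceLo, traceHi, avgWeight, and_false, if_false, LinearMap.comp_apply,
        LinearMap.proj_apply, leval_apply, dif_neg, not_false_eq_true, LinearMap.zero_apply]
      ring
  · have h2 : (F.pos : ℕ) < 𝒯.n F.dir := by omega
    have e2 := hhi ⟨F.pos, h2⟩ rfl
    simp only [Mesh.Face.avg, Mesh.Face.below, Mesh.Face.above, h1, h2, dif_pos, e2,
      traceLo, traceHi, avgWeight, false_and, if_false, LinearMap.comp_apply,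
      LinearMap.proj_apply, leval_apply, dif_neg, not_false_eq_true, LinearMap.zero_apply]
    ring

theorem Mesh.Face.normal_eq {𝒯 : Mesh d} (F : 𝒯.Face) :
    F.normal = F.sgn • Pi.single F.dir 1 := by
  by_cases h1 : 0 < (F.pos : ℕ)
  · simp only [Mesh.Face.normal, Mesh.Face.below, Mesh.Face.sgn, h1, dif_pos, if_true, one_smul]
  · simp only [Mesh.Face.normal, Mesh.Face.below, Mesh.Face.sgn, h1, dif_neg, if_false,
      not_false_eq_true, neg_smul, one_smul]

theorem Mesh.Face.avgNormalDeriv_eq {𝒯 : Mesh d} (F : 𝒯.Face) (u : 𝒯.Broken)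
    (x : Fin (d + 1) → ℝ) :
    F.avgNormalDeriv u x = F.sgn * F.avg (fun T => partialDeriv F.dir (u T)) x := by
  rw [Mesh.Face.avgNormalDeriv, F.normal_eq, Finset.sum_eq_single F.dir]
  · simp [mul_comm]
  · intro i _ hi; simp [hi]
  · simp

theorem Mesh.Face.refCoord_point_lo {𝒯 : Mesh d} (F : 𝒯.Face) (t : Fin (𝒯.n F.dir))
    (ht : (t : ℕ) + 1 = F.pos) (y : Fin d → ℝ) : 𝒯.refCoord F.dir t (F.point y F.dir) = 1 := by
  have hh := 𝒯.h_pos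
  rw [Mesh.Face.point, Fin.insertNth_apply_same, Mesh.refCoord, ← ht]
  push_cast
  field_simp
  ring

theorem Mesh.Face.refCoord_point_hi {𝒯 : Mesh d} (F : 𝒯.Face) (t : Fin (𝒯.n F.dir))
    (ht : (t : ℕ) = F.pos) (y : Fin d → ℝ) : 𝒯.refCoord F.dir t (F.point y F.dir) = -1 := by
  rw [Mesh.Face.point, Fin.insertNth_apply_same, Mesh.refCoord, ← ht]
  simp

theorem Mesh.Face.removeNth_point {𝒯 : Mesh d} (F : 𝒯.Face) (y : Fin d → ℝ) :
    F.dir.removeNth (F.point y) = y := Fin.removeNth_insertNth _ _ _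

theorem Mesh.Face.jump_tensor {𝒯 : Mesh d} (F : 𝒯.Face)
    (p : (i : Fin (d + 1)) → Fin (𝒯.n i) → ℝ[X]) (y : Fin d → ℝ) :
    F.jump (𝒯.tensor p) (F.point y) =
      F.sgn * (jumpRef F.pos (p F.dir) * 𝒯.tensorTr F.dir p F.tr y) := by
  apply F.jump_eq
  · intro t ht
    rw [𝒯.tensor_eq_mul p F.dir, Fin.insertNth_apply_same, F.refCoord_point_lo t ht,
      F.removeNth_point, Fin.removeNth_insertNth]
  · intro t ht
    rw [𝒯.tensor_eq_mul p F.dir, Fin.insertNth_apply_same, F.refCoord_point_hi t ht,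
      F.removeNth_point, Fin.removeNth_insertNth]

theorem Mesh.Face.avgNormalDeriv_tensor {𝒯 : Mesh d} (F : 𝒯.Face)
    (p : (i : Fin (d + 1)) → Fin (𝒯.n i) → ℝ[X]) (y : Fin d → ℝ) :
    F.avgNormalDeriv (𝒯.tensor p) (F.point y) =
      F.sgn * (2 / 𝒯.h * avgDerivRef F.pos (p F.dir) * 𝒯.tensorTr F.dir p F.tr y) := by
  rw [F.avgNormalDeriv_eq, F.avg_eq (P := fun t => derivative (p F.dir t))
    (z := 2 / 𝒯.h * 𝒯.tensorTr F.dir p F.tr y), avgDerivRef_apply]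
  · ring
  · intro t ht
    rw [𝒯.partialDeriv_tensor, Fin.insertNth_apply_same, F.refCoord_point_lo t ht,
      F.removeNth_point, Fin.removeNth_insertNth]
    ring
  · intro t ht
    rw [𝒯.partialDeriv_tensor, Fin.insertNth_apply_same, F.refCoord_point_hi t ht,
      F.removeNth_point, Fin.removeNth_insertNth]
    ring

theorem Mesh.Face.integral_eq {𝒯 : Mesh d} (F : 𝒯.Face)
    (p q : (i : Fin (d + 1)) → Fin (𝒯.n i) → ℝ[X]) {f g : (Fin (d + 1) → ℝ) → ℝ} {a b : ℝ}
    (hf : ∀ y, f (F.point y) = F.sgn * (a * 𝒯.tensorTr F.dir p F.tr y))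
    (hg : ∀ y, g (F.point y) = F.sgn * (b * 𝒯.tensorTr F.dir q F.tr y)) :
    F.integral (fun x => f x * g x) = a * b *
      ∏ l, (𝒯.h / 2 * polyInt (p (F.dir.succAbove l) (F.tr l) * q (F.dir.succAbove l) (F.tr l))) := by
  rw [← 𝒯.setIntegral_tensorTr F.dir, ← integral_const_mul, Mesh.Face.integral]
  congr 1
  ext y
  change f (F.point y) * g (F.point y) = _
  rw [hf, hg, show ∀ s u v w z : ℝ, s * (u * v) * (s * (w * z)) = s * s * (u * w * (v * z)) by
    intros; ring, F.sgn_mul_self, one_mul]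

theorem Mesh.sum_face_eq (𝒯 : Mesh d) (c : (i : Fin (d + 1)) → Fin (𝒯.n i + 1) → ℝ)
    (p q : (i : Fin (d + 1)) → Fin (𝒯.n i) → ℝ[X]) :
    ∑ F : 𝒯.Face, c F.dir F.pos *
      ∏ l, (𝒯.h / 2 * polyInt (p (F.dir.succAbove l) (F.tr l) * q (F.dir.succAbove l) (F.tr l))) =
    ∑ i, (∑ f, c i f) * 𝒯.massTr i p q := by
  rw [← Equiv.sum_comp 𝒯.faceEquiv, Fintype.sum_sigma]
  refine Finset.sum_congr rfl fun i _ => ?_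
  rw [Fintype.sum_prod_type, Mesh.massTr, ← 𝒯.sum_prod_polyInt i.succAbove
    (fun l => p (i.succAbove l)) (fun l => q (i.succAbove l)), Finset.sum_mul]
  refine Finset.sum_congr rfl fun f _ => ?_
  rw [Finset.mul_sum]
  rfl

/-- Each face sees only the derivative in its normal direction, so grouping faces by direction
leaves no cross terms: every direction contributes its one-dimensional form times the masses of the
others. -/
theorem Mesh.form_tensor (𝒯 : Mesh d) (α₀ : ℝ) (k : ℕ)
    (p q : (i : Fin (d + 1)) → Fin (𝒯.n i) → ℝ[X]) :
    𝒯.form α₀ k (𝒯.tensor p) (𝒯.tensor q) =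
      ∑ i, 𝒯.h⁻¹ * refForm (𝒯.n i) (α₀ * (k : ℝ) ^ 2) (p i) (q i) * 𝒯.massTr i p q := by
  have h1 : ∀ p q : (i : Fin (d + 1)) → Fin (𝒯.n i) → ℝ[X],
      ∑ F : 𝒯.Face, F.integral (fun x => F.avgNormalDeriv (𝒯.tensor p) x *
        F.jump (𝒯.tensor q) x) =
      ∑ i, (∑ f, 2 / 𝒯.h * avgDerivRef f (p i) * jumpRef f (q i)) * 𝒯.massTr i p q := by
    intro p q
    rw [← 𝒯.sum_face_eq fun i f => 2 / 𝒯.h * avgDerivRef f (p i) * jumpRef f (q i)]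
    exact Finset.sum_congr rfl fun F _ =>
      F.integral_eq p q (F.avgNormalDeriv_tensor p) (F.jump_tensor q)
  have h2 : ∑ F : 𝒯.Face, (α₀ * (k : ℝ) ^ 2 / 𝒯.h) *
        F.integral (fun x => F.jump (𝒯.tensor p) x * F.jump (𝒯.tensor q) x) =
      ∑ i, (∑ f, (α₀ * (k : ℝ) ^ 2 / 𝒯.h) * (jumpRef f (p i) * jumpRef f (q i))) *
        𝒯.massTr i p q := by
    rw [← 𝒯.sum_face_eq fun i f => (α₀ * (k : ℝ) ^ 2 / 𝒯.h) *
      (jumpRef f (p i) * jumpRef f (q i))]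
    refine Finset.sum_congr rfl fun F _ => ?_
    rw [F.integral_eq p q (F.jump_tensor p) (F.jump_tensor q), mul_assoc (_ / _)]
  have hcomm : ∀ i, 𝒯.massTr i q p = 𝒯.massTr i p q := by
    intro i
    simp only [Mesh.massTr, refMass, mul_comm (q _ _)]
  rw [Mesh.form, h1 p q, h1 q p, h2, 𝒯.sum_integral_gradient_tensor, ← Finset.sum_sub_distrib,
    ← Finset.sum_sub_distrib, ← Finset.sum_add_distrib]
  refine Finset.sum_congr rfl fun i _ => ?_
  rw [hcomm, refForm_apply]
  simp only [mul_assoc, ← Finset.mul_sum]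
  field_simp

/-! ### Kronecker structure of the matrices and the diagonal bound -/

/-- The mass of a one-dimensional transported Legendre polynomial of degree `s`. -/
noncomputable def Mesh.mass1 (𝒯 : Mesh d) (s : ℕ) : ℝ := 𝒯.h / 2 * (2 / (2 * (s : ℝ) + 1))

theorem Mesh.mass1_pos (𝒯 : Mesh d) (s : ℕ) : 0 < 𝒯.mass1 s := by
  have := 𝒯.h_pos
  unfold Mesh.mass1; positivity

theorem Mesh.prod_refMass_refBasis (𝒯 : Mesh d) {k m : ℕ} (e : Fin m → Fin (d + 1))
    (T T' : (l : Fin m) → Fin (𝒯.n (e l))) (s s' : Fin m → Fin (k + 1)) :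
    ∏ l, (𝒯.h / 2 * refMass (refBasis (T l, s l)) (refBasis (T' l, s' l))) =
      Matrix.diagonal (fun j : ((l : Fin m) → Fin (𝒯.n (e l))) × (Fin m → Fin (k + 1)) =>
        ∏ l, 𝒯.mass1 (j.2 l)) (T, s) (T', s') := by
  simp only [refMass_refBasis]
  rw [Matrix.diagonal_apply]
  split_ifs with h
  · rw [Prod.mk.injEq] at h
    obtain ⟨rfl, rfl⟩ := h
    simp [Mesh.mass1]
  · have : ∃ l, (T l, s l) ≠ (T' l, s' l) := by
      by_contra! hc
      exact h (Prod.ext (funext fun l => congrArg Prod.fst (hc l))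
        (funext fun l => congrArg Prod.snd (hc l)))
    obtain ⟨l, hl⟩ := this
    exact Finset.prod_eq_zero (Finset.mem_univ l) (by rw [if_neg hl, mul_zero])

theorem Mesh.mass_eq_diagonal (𝒯 : Mesh d) (k : ℕ) :
    𝒯.mass k = Matrix.diagonal fun j => ∏ i, 𝒯.mass1 (j.2 i) := by
  ext i j
  rw [Mesh.mass, Matrix.of_apply, 𝒯.basisFun_eq_tensor, 𝒯.basisFun_eq_tensor, 𝒯.l2Inner_tensor]
  exact 𝒯.prod_refMass_refBasis id i.1 j.1 i.2 j.2

/-- Separation of the direction `i` in the labels of the basis functions. -/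
def Mesh.idxEquiv (𝒯 : Mesh d) (k : ℕ) (i : Fin (d + 1)) :
    𝒯.Idx k ≃ (Fin (𝒯.n i) × Fin (k + 1)) ×
      (((l : Fin d) → Fin (𝒯.n (i.succAbove l))) × (Fin d → Fin (k + 1))) :=
  ((Fin.insertNthEquiv (fun i => Fin (𝒯.n i)) i).symm.prodCongr
    (Fin.insertNthEquiv (fun _ => Fin (k + 1)) i).symm).trans (Equiv.prodProdProdComm _ _ _ _)

open scoped Kronecker

/-- By Legendre orthogonality the transversal mass factor is diagonal and positive, so definiteness
and diagonal entries are inherited from `refStiff`. -/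
theorem Mesh.stiff_eq_sum (𝒯 : Mesh d) (α₀ : ℝ) (k : ℕ) :
    𝒯.stiff α₀ k = ∑ i, 𝒯.h⁻¹ • (refStiff (𝒯.n i) k (α₀ * (k : ℝ) ^ 2) ⊗ₖ
      Matrix.diagonal (fun j : ((l : Fin d) → Fin (𝒯.n (i.succAbove l))) × (Fin d → Fin (k + 1)) =>
        ∏ l, 𝒯.mass1 (j.2 l))).submatrix (𝒯.idxEquiv k i) (𝒯.idxEquiv k i) := by
  ext a b
  rw [Mesh.stiff, Matrix.of_apply, 𝒯.basisFun_eq_tensor, 𝒯.basisFun_eq_tensor, 𝒯.form_tensor,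
    Matrix.sum_apply]
  refine Finset.sum_congr rfl fun i _ => ?_
  rw [Matrix.smul_apply, Matrix.submatrix_apply, Matrix.kroneckerMap_apply, smul_eq_mul,
    Mesh.massTr, 𝒯.prod_refMass_refBasis i.succAbove (fun l => a.1 (i.succAbove l))
      (fun l => b.1 (i.succAbove l)) (fun l => a.2 (i.succAbove l)) (fun l => b.2 (i.succAbove l)),
    mul_assoc]
  rfl

theorem Mesh.posDef_mass (𝒯 : Mesh d) (k : ℕ) : (𝒯.mass k).PosDef := by
  rw [𝒯.mass_eq_diagonal]
  exact Matrix.PosDef.diagonal fun j => Finset.prod_pos fun i _ => 𝒯.mass1_pos _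

theorem Mesh.posDef_stiff (𝒯 : Mesh d) {α₀ : ℝ} (hα : 5 ≤ α₀) {k : ℕ} (hk : 1 ≤ k) :
    (𝒯.stiff α₀ k).PosDef := by
  rw [𝒯.stiff_eq_sum]
  refine Matrix.posDef_sum Finset.univ_nonempty fun i _ => ?_
  refine Matrix.PosDef.smul ?_ (inv_pos.mpr 𝒯.h_pos)
  refine Matrix.PosDef.submatrix ?_ (𝒯.idxEquiv k i).injective
  exact (posDef_refStiff hk hα).kronecker
    (Matrix.PosDef.diagonal fun j => Finset.prod_pos fun i _ => 𝒯.mass1_pos _)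

theorem Mesh.stiff_diag_le (𝒯 : Mesh d) {α₀ : ℝ} (hα : 0 ≤ α₀) {k : ℕ} (hk : 1 ≤ k)
    (j : 𝒯.Idx k) :
    𝒯.stiff α₀ k j j ≤ ((d : ℝ) + 1) * ((4 * α₀ + 22) * (k : ℝ) ^ 2 * (2 * k + 1) / 𝒯.h ^ 2) *
      ∏ i, 𝒯.mass1 (j.2 i) := by
  have hh := 𝒯.h_pos
  rw [𝒯.stiff_eq_sum, Matrix.sum_apply]
  have hterm : ∀ i ∈ (Finset.univ : Finset (Fin (d + 1))),
      (𝒯.h⁻¹ • (refStiff (𝒯.n i) k (α₀ * (k : ℝ) ^ 2) ⊗ₖ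
      Matrix.diagonal (fun j : ((l : Fin d) → Fin (𝒯.n (i.succAbove l))) × (Fin d → Fin (k + 1)) =>
        ∏ l, 𝒯.mass1 (j.2 l))).submatrix (𝒯.idxEquiv k i) (𝒯.idxEquiv k i)) j j ≤
      (4 * α₀ + 22) * (k : ℝ) ^ 2 * (2 * k + 1) / 𝒯.h ^ 2 * ∏ i, 𝒯.mass1 (j.2 i) := by
    intro i _
    rw [Matrix.smul_apply, Matrix.submatrix_apply, Matrix.kroneckerMap_apply, smul_eq_mul,
      Matrix.diagonal_apply_eq, Fin.prod_univ_succAbove _ i]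
    change 𝒯.h⁻¹ * (refStiff (𝒯.n i) k (α₀ * (k : ℝ) ^ 2) (j.1 i, j.2 i) (j.1 i, j.2 i) *
      ∏ l, 𝒯.mass1 (j.2 (i.succAbove l))) ≤ _
    -- Trades the missing mass factor of direction `i`, equal to `h/(2s+1)` with `s ≤ k`, for
    -- `(2k+1)/h`; this is the third power of `k`.
    have hw : 1 ≤ (2 * (k : ℝ) + 1) / 𝒯.h * 𝒯.mass1 (j.2 i) := by
      have hs : ((j.2 i : ℕ) : ℝ) ≤ k := by exact_mod_cast Nat.lt_succ_iff.mp (j.2 i).isLt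
      have h1 : (2 * (k : ℝ) + 1) / 𝒯.h * 𝒯.mass1 (j.2 i) =
          (2 * (k : ℝ) + 1) / (2 * ((j.2 i : ℕ) : ℝ) + 1) := by
        rw [Mesh.mass1]; field_simp
      rw [h1, one_le_div (by positivity)]
      linarith
    have hr := refStiff_diag_le hk hα (j.1 i, j.2 i)
    have hpos : 0 < ∏ l, 𝒯.mass1 (j.2 (i.succAbove l)) :=
      Finset.prod_pos fun l _ => 𝒯.mass1_pos _
    set R := ∏ l, 𝒯.mass1 (j.2 (i.succAbove l))
    calc _ ≤ 𝒯.h⁻¹ * ((4 * α₀ + 22) * (k : ℝ) ^ 2 * R) := by gcongr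
      _ = 𝒯.h⁻¹ * ((4 * α₀ + 22) * (k : ℝ) ^ 2 * R) * 1 := (mul_one _).symm
      _ ≤ 𝒯.h⁻¹ * ((4 * α₀ + 22) * (k : ℝ) ^ 2 * R) *
          ((2 * (k : ℝ) + 1) / 𝒯.h * 𝒯.mass1 (j.2 i)) := by gcongr
      _ = _ := by ring
  refine (Finset.sum_le_card_nsmul _ _ _ hterm).trans (le_of_eq ?_)
  rw [Finset.card_univ, Fintype.card_fin, nsmul_eq_mul]
  push_cast
  ring

end IPDG

/-! ### Assembly of the constants -/

theorem mainTheorem5 (d : ℕ) :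
    ∃ αmin : ℝ, 0 < αmin ∧ ∀ α₀ : ℝ, αmin ≤ α₀ →
      (∀ (𝒯 : IPDG.Mesh d) (k : ℕ), 1 ≤ k →
        (𝒯.mass k).PosDef ∧ (𝒯.stiff α₀ k).PosDef) ∧
      ∀ c : ℝ, 0 < c → ∃ C : ℝ, 0 < C ∧
        ∀ (𝒯 : IPDG.Mesh d) (k m : ℕ) (ω : ℝ), 1 ≤ k → 1 ≤ m →
          c / ((k : ℝ) + 1) ≤ ω →
          ENNReal.ofReal ω *
            IPDG.specRadius ((𝒯.diagStiff α₀ k)⁻¹ * 𝒯.stiff α₀ k) ≤ 1 →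
          ∀ g : 𝒯.Idx k → ℝ,
            IPDG.normAs (𝒯.stiff α₀ k) 0
              (Matrix.mulVec
                (IPDG.symPow (𝒯.mass k) (-(1 / 2)) * 𝒯.stiff α₀ k * 𝒯.smoother α₀ k ω m) g)
              ≤ C * ((k : ℝ) ^ 2 / (𝒯.h * (m : ℝ))) * IPDG.normAs (𝒯.stiff α₀ k) 1 g := by
  refine ⟨5, by norm_num, fun α₀ hα => ⟨fun 𝒯 k hk => ⟨𝒯.posDef_mass k, 𝒯.posDef_stiff hα hk⟩,
    fun c hc => ?_⟩⟩
  have hα0 : 0 ≤ α₀ := by linarith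
  -- The `2` is `8/4`, from `(2k+1)(k+1) ≤ 8k²` for `k ≥ 1` and `(2m+1)² ≥ 4m²`.
  refine ⟨√(2 * ((d : ℝ) + 1) * (4 * α₀ + 22) / c), by positivity, ?_⟩
  intro 𝒯 k m ω hk hm hω hρ g
  have hh := 𝒯.h_pos
  have hk1 : (1 : ℝ) ≤ k := by exact_mod_cast hk
  have hm1 : (1 : ℝ) ≤ m := by exact_mod_cast hm
  have hω0 : 0 < ω := lt_of_lt_of_le (by positivity) hω
  have h := IPDG.normAs_chebP_le (𝒯.posDef_stiff hα hk) (𝒯.mass_eq_diagonal k)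
    (fun j => Finset.prod_pos fun i _ => 𝒯.mass1_pos _) (𝒯.stiff_diag_le hα0 hk) hω0 hρ m g
  refine h.trans (mul_le_mul_of_nonneg_right ?_ (Real.sqrt_nonneg _))
  rw [Real.sqrt_le_left (by positivity), mul_pow, Real.sq_sqrt (by positivity)]
  have h1 : 1 / (ω * (2 * (m : ℝ) + 1) ^ 2) ≤ ((k : ℝ) + 1) / (c * (4 * (m : ℝ) ^ 2)) := by
    rw [div_le_iff₀ (by positivity)] at hω
    rw [div_le_div_iff₀ (by positivity) (by positivity), one_mul]
    calc c * (4 * (m : ℝ) ^ 2) ≤ (ω * (k + 1)) * (2 * (m : ℝ) + 1) ^ 2 := by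
          gcongr
          nlinarith
      _ = _ := by ring
  calc _ ≤ ((d : ℝ) + 1) * ((4 * α₀ + 22) * (k : ℝ) ^ 2 * (2 * k + 1) / 𝒯.h ^ 2) *
        (((k : ℝ) + 1) / (c * (4 * (m : ℝ) ^ 2))) := by gcongr
    _ = ((d : ℝ) + 1) * (4 * α₀ + 22) * (k : ℝ) ^ 2 / (4 * c * 𝒯.h ^ 2 * (m : ℝ) ^ 2) *
        ((2 * k + 1) * (k + 1)) := by field_simp
    _ ≤ ((d : ℝ) + 1) * (4 * α₀ + 22) * (k : ℝ) ^ 2 / (4 * c * 𝒯.h ^ 2 * (m : ℝ) ^ 2) *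
        (8 * (k : ℝ) ^ 2) := by
          refine mul_le_mul_of_nonneg_left ?_ (by positivity)
          nlinarith
    _ = _ := by field_simp; ring
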